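/- Consider the scale-mixture-of-skew-normal linear mixed model for subjects $i=1,\dots,n$, $$\mathbf Y_i=\mathbf X_i\beta+\mathbf Z_i\mathbf b_i+\epsilon_i ,$$ with fixed design matrices $\mathbf X_i\in\mathbb R^{n_i\times l}$, $\mathbf Z_i\in\mathbb R^{n_i\times q}$, where $\beta\in\mathbb R^l$, $\lambda\in\mathbb R^q$, and $\mathbf D\in\mathbb R^{q\times q}$, $\Sigma_i\in\mathbb R^{n_i\times n_i}$ are symmetric positive definite. The triples $(U_i,\mathbf b_i,\epsilon_i)$ are independent over $i$; $U_i>0$ has law $H$ with $k_1=\mathrm E\{U_i^{-1/2}\}<\infty$; and, given $U_i=u$, the vector $(\mathbf b_i^\top,\epsilon_i^\top)^\top$ has the density on $\mathbb R^{q+n_i}$ $$w\mapsto 2\,\phi_{q+n_i}(w;\mu,u^{-1}S_i)\,\Phi\!\left(u^{1/2}\,\tilde\lambda^\top S_i^{-1/2}(w-\mu)\right),\qquad \mu=\begin{pmatrix}c\Delta\\0\end{pmatrix},\quad S_i=\begin{pmatrix}\mathbf D&0\\0&\Sigma_i\end{pmatrix},\quad \tilde\lambda=\begin{pmatrix}\lambda\\0\end{pmatrix},$$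 that is, $(\mathbf b_i^\top,\epsilon_i^\top)^\top\sim\mathrm{SMSN}_{q+n_i}(\mu,S_i,\tilde\lambda;H)$ with mixing factor $U_i$. Here $\phi_p(\cdot;\mu,S)$ is the $p$-variate normal density, $\phi$ and $\Phi$ are the standard normal density and distribution function, square roots of matrices are the symmetric positive definite ones, $c=-\sqrt{2/\pi}\,k_1$, $\Delta=\mathbf D^{1/2}\delta$ and $\delta=\lambda/\sqrt{1+\lambda^\top\lambda}$. Put $$\Psi_i=\Sigma_i+\mathbf Z_i\mathbf D\mathbf Z_i^\top,\quad \zeta=\mathbf D^{-1/2}\lambda,\quad \Lambda_i=(\mathbf D^{-1}+\mathbf Z_i^\top\Sigma_i^{-1}\mathbf Z_i)^{-1},\quad \bar\lambda_i=\frac{\Psi_i^{-1/2}\mathbf Z_i\mathbf D\zeta}{\sqrt{1+\zeta^\top\Lambda_i\zeta}},$$ and, for $\mathbf y_i\in\mathbb R^{n_i}$, $$\mathbf y_{0i}=\Psi_i^{-1/2}(\mathbf y_i-\mathbf X_i\beta-c\mathbf Z_i\Delta),\quad A_i=\bar\lambda_i^\top\mathbf y_{0i},\quad \mu_{bi}=c\Delta+\mathbf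 D\mathbf Z_i^\top\Psi_i^{-1/2}\mathbf y_{0i},$$ $$\tau_{-1i}=\mathrm E\{U_i^{-1/2}W_\Phi(U_i^{1/2}A_i)\mid\mathbf Y_i=\mathbf y_i\},\qquad W_\Phi=\phi/\Phi .$$ Then, for every $i$, $\mathbf b_i$ is integrable, and the conditional mean $\mathbf y_i\mapsto\mathrm E\{\mathbf b_i\mid\mathbf Y_i=\mathbf y_i\}$ is the minimum mean-squared-error predictor of $\mathbf b_i$ from $\mathbf Y_i$: it minimizes $\mathrm E\|\mathbf b_i-g(\mathbf Y_i)\|^2\in[0,\infty]$ over all measurable $g:\mathbb R^{n_i}\to\mathbb R^q$, and if the minimum is finite, any other minimizer agrees with it almost surely. Moreover, for almost every $\mathbf y_i$ with respect to the law of $\mathbf Y_i$, the conditional means $\mathrm E\{\mathbf b_i\mid\mathbf Y_i=\mathbf y_i\}$ and $\tau_{-1i}$ exist (as absolutely convergent integrals) and $$\mathrm E\{\mathbf b_i\mid\mathbf Y_i=\mathbf y_i\}=\mathrm E\bigl\{\mathrm E\{\mathbf b_i\mid U_i,\mathbf Y_i=\mathbf y_i\}\mid\mathbf Y_i=\mathbf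 y_i\bigr\}=\mu_{bi}+\frac{\tau_{-1i}}{\sqrt{1+\zeta^\top\Lambda_i\zeta}}\,\Lambda_i\zeta .$$ -/

import Mathlib

open MeasureTheory ProbabilityTheory Matrix
open scoped MatrixOrder ENNReal

noncomputable section

namespace SkewLMM

/-! ### Square roots and normal densities -/

/-- `S^{1/2}`: the symmetric positive semidefinite square root of a positive definite matrix. -/
def sqrtM {ι : Type*} [Fintype ι] [DecidableEq ι] (S : Matrix ι ι ℝ) : Matrix ι ι ℝ :=
  CFC.sqrt S

/-- `S^{-1/2}`: the symmetric matrix with `S^{-1/2} S^{-1/2} = S⁻¹`. -/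
def invSqrtM {ι : Type*} [Fintype ι] [DecidableEq ι] (S : Matrix ι ι ℝ) : Matrix ι ι ℝ :=
  CFC.sqrt S⁻¹

/-- `φ_p(y; μ, S)`: the density of the `p`-variate normal law with mean `μ` and positive definite
covariance matrix `S`. -/
def normalPDF {ι : Type*} [Fintype ι] [DecidableEq ι] (μ : ι → ℝ) (S : Matrix ι ι ℝ)
    (y : ι → ℝ) : ℝ :=
  (Real.sqrt ((2 * Real.pi) ^ Fintype.card ι * S.det))⁻¹ *
    Real.exp (-((y - μ) ⬝ᵥ S⁻¹ *ᵥ (y - μ)) / 2)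

/-- `Φ`: the standard normal cumulative distribution function. -/
def stdNormalCDF (x : ℝ) : ℝ := cdf (gaussianReal 0 1) x

/-- `W_Φ(x) = φ(x) / Φ(x)` for the standard normal density `φ` and distribution function `Φ`. -/
def WPhi (x : ℝ) : ℝ := gaussianPDFReal 0 1 x / stdNormalCDF x

/-! ### Scale mixtures of skew-normal laws -/

/-- The density of `SN_p(μ, u⁻¹ S, lam)`,
`2 φ_p(w; μ, u⁻¹ S) Φ(u^{1/2} lamᵀ S^{-1/2} (w - μ))`, for `u > 0`. -/
def scaledSkewNormalPDF {ι : Type*} [Fintype ι] [DecidableEq ι] (μ : ι → ℝ) (S : Matrix ι ι ℝ)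
    (lam : ι → ℝ) (u : ℝ) (w : ι → ℝ) : ℝ :=
  2 * normalPDF μ (u⁻¹ • S) w *
    stdNormalCDF (Real.sqrt u * (lam ⬝ᵥ invSqrtM S *ᵥ (w - μ)))

/-- `W ~ SMSN_p(μ, S, lam; H)` with mixing factor `U`: `U` has law `H` and, given `U = u`, `W` has
law `SN_p(μ, u⁻¹ S, lam)`. That is, `(U, W)` has the joint density
`2 φ_p(w; μ, u⁻¹ S) Φ(u^{1/2} lamᵀ S^{-1/2} (w - μ))` with respect to `H(du) dw`. Integrating `u`
out gives the density `2 ∫ φ_p(w; μ, u⁻¹ S) Φ(u^{1/2} lamᵀ S^{-1/2} (w - μ)) dH(u)` of `W`. -/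
def IsSMSN {Ω : Type*} [MeasurableSpace Ω] {ι : Type*} [Fintype ι] [DecidableEq ι]
    (P : Measure Ω) (U : Ω → ℝ) (W : Ω → ι → ℝ)
    (μ : ι → ℝ) (S : Matrix ι ι ℝ) (lam : ι → ℝ) (H : Measure ℝ) : Prop :=
  P.map (fun ω => (U ω, W ω)) =
    (H.prod (volume : Measure (ι → ℝ))).withDensity
      (fun p => ENNReal.ofReal (scaledSkewNormalPDF μ S lam p.1 p.2))

/-! ### The linear mixed model -/

/-- Design matrices and parameters of a linear mixed model with SMSN random terms, for `n` subjects
with `m i` observations on subject `i`, `l` fixed effects and `q` random effects. -/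
structure Params (n q l : ℕ) (m : Fin n → ℕ) where
  /-- fixed effects design matrices -/
  X : (i : Fin n) → Matrix (Fin (m i)) (Fin l) ℝ
  /-- random effects design matrices -/
  Z : (i : Fin n) → Matrix (Fin (m i)) (Fin q) ℝ
  /-- fixed effects -/
  beta : Fin l → ℝ
  /-- scale matrix of the random effects -/
  D : Matrix (Fin q) (Fin q) ℝ
  /-- scale matrices of the errors -/
  Sig : (i : Fin n) → Matrix (Fin (m i)) (Fin (m i)) ℝ
  /-- skewness parameter -/
  lam : Fin q → ℝ
  /-- law of the mixing factors -/
  H : Measure ℝ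
  posDef_D : D.PosDef
  posDef_Sig : ∀ i, (Sig i).PosDef
  isProbabilityMeasure_H : IsProbabilityMeasure H
  /-- the mixing factor is positive -/
  H_nonpos : H (Set.Iic 0) = 0
  /-- `E[U^{-1/2}]` is finite -/
  integrable_k1 : Integrable (fun u : ℝ => (Real.sqrt u)⁻¹) H

namespace Params

variable {n q l : ℕ} {m : Fin n → ℕ} (M : Params n q l m)

/-- `k₁ = E[U^{-1/2}]` -/
def k1 : ℝ := ∫ u, (Real.sqrt u)⁻¹ ∂M.H

/-- `c = -√(2/π) k₁` -/
def c : ℝ := -Real.sqrt (2 / Real.pi) * M.k1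

/-- `δ = lam / √(1 + lamᵀ lam)` -/
def delta : Fin q → ℝ := (Real.sqrt (1 + M.lam ⬝ᵥ M.lam))⁻¹ • M.lam

/-- `Δ = D^{1/2} δ` -/
def Delta : Fin q → ℝ := sqrtM M.D *ᵥ M.delta

/-- `Ψ_i = Σ_i + Z_i D Z_iᵀ` -/
def Psi (i : Fin n) : Matrix (Fin (m i)) (Fin (m i)) ℝ := M.Sig i + M.Z i * M.D * (M.Z i)ᵀ

/-- `ζ = D^{-1/2} lam` -/
def zeta : Fin q → ℝ := invSqrtM M.D *ᵥ M.lam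

/-- `Λ_i = (D⁻¹ + Z_iᵀ Σ_i⁻¹ Z_i)⁻¹` -/
def Lambda (i : Fin n) : Matrix (Fin q) (Fin q) ℝ :=
  (M.D⁻¹ + (M.Z i)ᵀ * (M.Sig i)⁻¹ * M.Z i)⁻¹

/-- `√(1 + ζᵀ Λ_i ζ)` -/
def s (i : Fin n) : ℝ := Real.sqrt (1 + M.zeta ⬝ᵥ M.Lambda i *ᵥ M.zeta)

/-- `Ψ_i^{-1/2} Z_i D ζ / √(1 + ζᵀ Λ_i ζ)` -/
def lamBar (i : Fin n) : Fin (m i) → ℝ :=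
  (M.s i)⁻¹ • ((invSqrtM (M.Psi i) * M.Z i * M.D) *ᵥ M.zeta)

/-- `y_{0i} = Ψ_i^{-1/2} (y_i - X_i β - c Z_i Δ)` -/
def y0 (i : Fin n) (y : Fin (m i) → ℝ) : Fin (m i) → ℝ :=
  invSqrtM (M.Psi i) *ᵥ (y - M.X i *ᵥ M.beta - M.c • (M.Z i *ᵥ M.Delta))

/-- `A_i`, the inner product of `lamBar i` and `y_{0i}` -/
def A (i : Fin n) (y : Fin (m i) → ℝ) : ℝ := M.lamBar i ⬝ᵥ M.y0 i y

/-- `μ_{bi} = c Δ + D Z_iᵀ Ψ_i^{-1/2} y_{0i}` -/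
def muB (i : Fin n) (y : Fin (m i) → ℝ) : Fin q → ℝ :=
  M.c • M.Delta + (M.D * (M.Z i)ᵀ * invSqrtM (M.Psi i)) *ᵥ M.y0 i y

/-- The random effects `b i`, errors `e i`, mixing factors `U i` and responses `Y i` follow the
model: `Y_i = X_i β + Z_i b_i + e_i`, the triples `(U_i, b_i, e_i)` are independent across
subjects, and `(b_i, e_i)` is SMSN with location `(c Δ, 0)`, scale matrix `diag(D, Σ_i)`,
skewness `(lam, 0)` and mixing factor `U_i` of law `H`. -/
structure IsModel {Ω : Type*} [MeasurableSpace Ω] (P : Measure Ω)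
    (b : Fin n → Ω → Fin q → ℝ) (e : (i : Fin n) → Ω → Fin (m i) → ℝ)
    (U : Fin n → Ω → ℝ) (Y : (i : Fin n) → Ω → Fin (m i) → ℝ) : Prop where
  measurable_b : ∀ i, Measurable (b i)
  measurable_e : ∀ i, Measurable (e i)
  measurable_U : ∀ i, Measurable (U i)
  response : ∀ i ω, Y i ω = M.X i *ᵥ M.beta + M.Z i *ᵥ b i ω + e i ω
  indep : iIndepFun (fun i ω => (U i ω, b i ω, e i ω)) P
  smsn : ∀ i, IsSMSN P (U i) (fun ω => Sum.elim (b i ω) (e i ω))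
    (Sum.elim (M.c • M.Delta) 0) (Matrix.fromBlocks M.D 0 0 (M.Sig i)) (Sum.elim M.lam 0) M.H

end Params

/-! ### Conditional means and mean squared error -/

/-- `E[V | Y = y]`: the mean of the regular conditional distribution of `V` given `Y = y`. -/
def condMean {Ω : Type*} [MeasurableSpace Ω] (P : Measure Ω) [IsFiniteMeasure P]
    {q : ℕ} {β : Type*} [MeasurableSpace β] (V : Ω → Fin q → ℝ) (Y : Ω → β) (y : β) : Fin q → ℝ :=
  ∫ v, v ∂(condDistrib V Y P y)

/-- The mean squared error `E ‖V - g(Y)‖²` (Euclidean norm), in `[0, ∞]`. -/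
def mse {Ω : Type*} [MeasurableSpace Ω] (P : Measure Ω) {q k : ℕ}
    (V : Ω → Fin q → ℝ) (Y : Ω → Fin k → ℝ) (g : (Fin k → ℝ) → Fin q → ℝ) : ℝ≥0∞ :=
  ∫⁻ ω, ENNReal.ofReal (∑ j, (V ω j - g (Y ω) j) ^ 2) ∂P

/-- `g(Y)` is the minimum mean squared error predictor of `V` from `Y`: `g` minimizes the mean
squared error among all measurable functions and, if the minimum is finite, every other minimizer
agrees with `g` almost surely. -/
def IsMinMSEPredictor {Ω : Type*} [MeasurableSpace Ω] (P : Measure Ω) {q k : ℕ}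
    (V : Ω → Fin q → ℝ) (Y : Ω → Fin k → ℝ) (g : (Fin k → ℝ) → Fin q → ℝ) : Prop :=
  Measurable g ∧
  ∀ h : (Fin k → ℝ) → Fin q → ℝ, Measurable h →
    mse P V Y g ≤ mse P V Y h ∧
    (mse P V Y g ≠ ∞ → mse P V Y h = mse P V Y g → h =ᵐ[P.map Y] g)

/-- The integrand `u^{-1/2} W_Φ(u^{1/2} A)` of `τ_{-1i}`. -/
def tauIntegrand (A u : ℝ) : ℝ := (Real.sqrt u)⁻¹ * WPhi (Real.sqrt u * A)

/-- `E[U^{-1/2} W_Φ(U^{1/2} A(y)) | Y = y]`, an integral over the conditional law of `U`. -/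
def tauNegOne {Ω : Type*} [MeasurableSpace Ω] (P : Measure Ω) [IsFiniteMeasure P]
    {k : ℕ} (U : Ω → ℝ) (Y : Ω → Fin k → ℝ) (A : (Fin k → ℝ) → ℝ) (y : Fin k → ℝ) : ℝ :=
  ∫ u, tauIntegrand (A y) u ∂(condDistrib U Y P y)

end SkewLMM

end

noncomputable section

namespace SkewLMM

section

/-! ### The standard normal distribution function -/

lemma stdNormalCDF_eq_integral (x : ℝ) :
    stdNormalCDF x = ∫ t in Set.Iic x, gaussianPDFReal 0 1 t := by
  rw [stdNormalCDF, cdf_eq_real, measureReal_def, gaussianReal_apply_eq_integral _ one_ne_zero,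
    ENNReal.toReal_ofReal (integral_nonneg fun t => gaussianPDFReal_nonneg _ _ _)]

@[fun_prop]
lemma continuous_gaussianPDFReal (μ : ℝ) (v : NNReal) : Continuous (gaussianPDFReal μ v) := by
  unfold gaussianPDFReal
  fun_prop

lemma hasDerivAt_stdNormalCDF (x : ℝ) :
    HasDerivAt stdNormalCDF (gaussianPDFReal 0 1 x) x := by
  have hi := integrable_gaussianPDFReal 0 1
  have h : stdNormalCDF = fun y => (∫ t in (0 : ℝ)..y, gaussianPDFReal 0 1 t) + stdNormalCDF 0 := by
    ext y
    rw [stdNormalCDF_eq_integral, stdNormalCDF_eq_integral,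
      ← intervalIntegral.integral_Iic_sub_Iic hi.integrableOn hi.integrableOn, sub_add_cancel]
  rw [h]
  exact (intervalIntegral.integral_hasDerivAt_right hi.intervalIntegrable
    (stronglyMeasurable_gaussianPDFReal 0 1).stronglyMeasurableAtFilter
    (continuous_gaussianPDFReal 0 1).continuousAt).add_const _

@[fun_prop]
lemma continuous_stdNormalCDF : Continuous stdNormalCDF :=
  continuous_iff_continuousAt.2 fun x => (hasDerivAt_stdNormalCDF x).continuousAt

lemma stdNormalCDF_pos (x : ℝ) : 0 < stdNormalCDF x := by
  rw [stdNormalCDF_eq_integral]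
  rw [setIntegral_pos_iff_support_of_nonneg_ae
    (ae_of_all _ fun t => gaussianPDFReal_nonneg _ _ _) (integrable_gaussianPDFReal 0 1).integrableOn]
  have : Function.support (gaussianPDFReal 0 1) = Set.univ :=
    Set.eq_univ_of_forall fun t => (gaussianPDFReal_pos 0 1 t one_ne_zero).ne'
  rw [this, Set.univ_inter]
  simp

lemma stdNormalCDF_le_one (x : ℝ) : stdNormalCDF x ≤ 1 := cdf_le_one _ _

lemma gaussianReal_Iic (v : NNReal) (hv : 0 < v) (k : ℝ) :
    (gaussianReal 0 v).real (Set.Iic k) = stdNormalCDF (k / Real.sqrt v) := by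
  have hs : 0 < Real.sqrt v := Real.sqrt_pos.2 hv
  have h := gaussianReal_map_div_const (μ := 0) (v := v) (Real.sqrt v)
  have h1 : v / (.mk (Real.sqrt v ^ 2) (sq_nonneg _) : NNReal) = 1 := by
    ext
    simp [hv.ne']
  rw [h1, zero_div] at h
  rw [stdNormalCDF, cdf_eq_real, ← h, map_measureReal_apply (by fun_prop) measurableSet_Iic]
  congr 1
  ext x
  simp [div_le_div_iff_of_pos_right hs]

/-! ### Standard normal vectors -/

variable {ι : Type*} [Fintype ι]

@[fun_prop]
lemma continuous_dotProduct_of {X : Type*} [TopologicalSpace X] {f g : X → ι → ℝ}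
    (hf : Continuous f) (hg : Continuous g) : Continuous fun x => f x ⬝ᵥ g x :=
  hf.dotProduct hg

@[fun_prop]
lemma continuous_mulVec_of {X κ : Type*} [TopologicalSpace X] {g : X → ι → ℝ}
    (M : Matrix κ ι ℝ) (hg : Continuous g) : Continuous fun x => M *ᵥ g x :=
  continuous_const.matrix_mulVec hg

lemma pi_gaussianReal_eq_withDensity :
    Measure.pi (fun _ : ι => gaussianReal 0 1) =
      (volume : Measure (ι → ℝ)).withDensity
        (fun z => ENNReal.ofReal (∏ i, gaussianPDFReal 0 1 (z i))) := by
  refine Measure.pi_eq fun s hs => ?_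
  have hint : Integrable (fun z : ι → ℝ => ∏ i, gaussianPDFReal 0 1 (z i)) :=
    Integrable.fintype_prod (f := fun (_ : ι) => gaussianPDFReal 0 1)
      fun _ => integrable_gaussianPDFReal 0 1
  rw [withDensity_apply _ (MeasurableSet.univ_pi hs),
    ← ofReal_integral_eq_lintegral_ofReal hint.integrableOn
      (ae_of_all _ fun z => Finset.prod_nonneg fun i _ => gaussianPDFReal_nonneg _ _ _),
    volume_pi, Measure.restrict_pi_pi,
    integral_fintype_prod_eq_prod (fun _ => gaussianPDFReal 0 1),
    ENNReal.ofReal_prod_of_nonneg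
      fun i _ => integral_nonneg fun t => gaussianPDFReal_nonneg _ _ _]
  exact Finset.prod_congr rfl fun i _ => (gaussianReal_apply_eq_integral _ one_ne_zero _).symm

lemma prod_gaussianPDFReal (z : ι → ℝ) :
    ∏ i, gaussianPDFReal 0 1 (z i) =
      (Real.sqrt (2 * Real.pi))⁻¹ ^ Fintype.card ι * Real.exp (-(z ⬝ᵥ z) / 2) := by
  simp only [gaussianPDFReal, Finset.prod_mul_distrib, ← Real.exp_sum]
  simp [dotProduct, Finset.sum_div, neg_div, ← sq]

lemma integral_pi_gaussianReal (f : (ι → ℝ) → ℝ) :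
    ∫ z, f z ∂(Measure.pi fun _ : ι => gaussianReal 0 1) =
      (Real.sqrt (2 * Real.pi))⁻¹ ^ Fintype.card ι *
        ∫ z, Real.exp (-(z ⬝ᵥ z) / 2) * f z := by
  rw [pi_gaussianReal_eq_withDensity, integral_withDensity_eq_integral_toReal_smul
    (by fun_prop) (by simp), ← integral_const_mul]
  congr 1 with z
  rw [ENNReal.toReal_ofReal (Finset.prod_nonneg fun i _ => gaussianPDFReal_nonneg _ _ _),
    prod_gaussianPDFReal, smul_eq_mul, mul_assoc]

lemma pi_gaussianReal_map_dotProduct (a : ι → ℝ) :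
    (Measure.pi fun _ : ι => gaussianReal 0 1).map (fun z => a ⬝ᵥ z) =
      gaussianReal 0 (a ⬝ᵥ a).toNNReal := by
  have h := IsGaussian.map_eq_gaussianReal (μ := stdGaussian (EuclideanSpace ℝ ι))
    (innerSL ℝ (WithLp.toLp 2 a))
  rw [integral_strongDual_stdGaussian, variance_dual_stdGaussian, ← map_pi_eq_stdGaussian,
    Measure.map_map (by fun_prop) (by fun_prop)] at h
  convert h using 2
  · ext z
    simp [PiLp.inner_apply, dotProduct, mul_comm]
  · simp [EuclideanSpace.norm_sq_eq, dotProduct, ← sq]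

lemma integral_stdNormalCDF_gaussianReal (v : NNReal) (k : ℝ) :
    ∫ w, stdNormalCDF (k + w) ∂(gaussianReal 0 v) =
      stdNormalCDF (k / Real.sqrt (1 + v)) := by
  have h1 : ∫ w, stdNormalCDF (k + w) ∂(gaussianReal 0 v) =
      ∫ w, stdNormalCDF (k - w) ∂(gaussianReal 0 v) := by
    have := gaussianReal_map_neg (μ := 0) (v := v)
    rw [neg_zero] at this
    conv_lhs => rw [← this]
    rw [integral_map (by fun_prop)
      (by fun_prop : Continuous fun w => stdNormalCDF (k + w)).aestronglyMeasurable]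
    simp [sub_eq_add_neg]
  have h2 : (gaussianReal 0 v ∗ gaussianReal 0 1) (Set.Iic k) =
      ∫⁻ w, ENNReal.ofReal (stdNormalCDF (k - w)) ∂(gaussianReal 0 v) := by
    rw [Measure.conv, Measure.map_apply (by fun_prop) measurableSet_Iic,
      Measure.prod_apply (measurableSet_Iic.preimage (by fun_prop))]
    congr 1 with w
    rw [stdNormalCDF, ofReal_cdf]
    congr 1
    ext x
    simp [le_sub_iff_add_le']
  rw [h1, integral_eq_lintegral_of_nonneg_ae (ae_of_all _ fun w => (stdNormalCDF_pos _).le)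
    (by fun_prop : Continuous fun w => stdNormalCDF (k - w)).aestronglyMeasurable, ← h2,
    gaussianReal_conv_gaussianReal, zero_add, ← measureReal_def,
    gaussianReal_Iic _ (by positivity)]
  simp [add_comm]

/-- The convolution of `Φ(k + aᵀz)` with a standard normal vector, up to normalisation. -/
lemma integral_exp_mul_stdNormalCDF (a : ι → ℝ) (k : ℝ) :
    ∫ z, Real.exp (-(z ⬝ᵥ z) / 2) * stdNormalCDF (k + a ⬝ᵥ z) =
      Real.sqrt (2 * Real.pi) ^ Fintype.card ι *
        stdNormalCDF (k / Real.sqrt (1 + a ⬝ᵥ a)) := by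
  have h := integral_stdNormalCDF_gaussianReal (a ⬝ᵥ a).toNNReal k
  rw [← pi_gaussianReal_map_dotProduct, integral_map (by fun_prop : Continuous fun z => a ⬝ᵥ z).aemeasurable
    (by fun_prop : Continuous fun w => stdNormalCDF (k + w)).aestronglyMeasurable,
    integral_pi_gaussianReal, Real.coe_toNNReal _ (by simpa using dotProduct_star_self_nonneg a),
    inv_pow, inv_mul_eq_iff_eq_mul₀ (by positivity)] at h
  exact h

end

section

variable {ι : Type*} [Fintype ι]

lemma dotProduct_self_nonneg_real (v : ι → ℝ) : 0 ≤ v ⬝ᵥ v := by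
  simpa using dotProduct_star_self_nonneg v

lemma integrable_exp_neg_mul_dotProduct {b : ℝ} (hb : 0 < b) :
    Integrable fun z : ι → ℝ => Real.exp (-b * (z ⬝ᵥ z)) := by
  have := Integrable.fintype_prod (ι := ι) (f := fun _ x => Real.exp (-b * x ^ 2))
    (μ := fun _ => volume) fun _ => integrable_exp_neg_mul_sq hb
  refine this.congr (ae_of_all _ fun z => ?_)
  simp only [← Real.exp_sum, dotProduct, Finset.mul_sum, sq]

lemma hasDerivAt_exp_neg_dotProduct (z v : ι → ℝ) (t : ℝ) :
    HasDerivAt (fun t : ℝ => Real.exp (-((z - t • v) ⬝ᵥ (z - t • v)) / 2))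
      (((z - t • v) ⬝ᵥ v) * Real.exp (-((z - t • v) ⬝ᵥ (z - t • v)) / 2)) t := by
  have h : (fun t : ℝ => -((z - t • v) ⬝ᵥ (z - t • v)) / 2) =
      fun t => -(z ⬝ᵥ z) / 2 + t * (z ⬝ᵥ v) - t ^ 2 * ((v ⬝ᵥ v) / 2) := by
    ext t
    simp only [sub_dotProduct, dotProduct_sub, smul_dotProduct, dotProduct_smul, smul_eq_mul,
      dotProduct_comm v z]
    ring
  have hd : HasDerivAt (fun t : ℝ => -((z - t • v) ⬝ᵥ (z - t • v)) / 2)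
      ((z - t • v) ⬝ᵥ v) t := by
    rw [h]
    have := (((hasDerivAt_id t).mul_const (z ⬝ᵥ v)).const_add (-(z ⬝ᵥ z) / 2)).sub
      ((hasDerivAt_pow 2 t).mul_const ((v ⬝ᵥ v) / 2))
    refine this.congr_deriv ?_
    simp only [sub_dotProduct, smul_dotProduct, smul_eq_mul]
    norm_num
    ring
  simpa [mul_comm] using hd.exp

/-- Gaussian domination of the derivative of a translated normal density. -/
lemma abs_deriv_exp_neg_dotProduct_le (z v : ι → ℝ) {t : ℝ} (ht : |t| ≤ 1) :
    |((z - t • v) ⬝ᵥ v) * Real.exp (-((z - t • v) ⬝ᵥ (z - t • v)) / 2)| ≤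
      (8 + 2 * (v ⬝ᵥ v)) * Real.exp ((v ⬝ᵥ v) / 2) * Real.exp (-(1 / 8) * (z ⬝ᵥ z)) := by
  set w := z - t • v with hw
  have ht2 : t ^ 2 ≤ 1 := by rw [← sq_abs]; exact pow_le_one₀ (abs_nonneg t) ht
  have hv := dotProduct_self_nonneg_real v
  have hz := dotProduct_self_nonneg_real z
  have hww : z ⬝ᵥ z / 2 - v ⬝ᵥ v ≤ w ⬝ᵥ w := by
    have h1 := dotProduct_self_nonneg_real (z - (2 * t) • v)
    have : w ⬝ᵥ w = z ⬝ᵥ z / 2 - t ^ 2 * (v ⬝ᵥ v) +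
        (z - (2 * t) • v) ⬝ᵥ (z - (2 * t) • v) / 2 := by
      simp only [hw, sub_dotProduct, dotProduct_sub, smul_dotProduct, dotProduct_smul, smul_eq_mul,
        dotProduct_comm v z]
      ring
    nlinarith
  have hwv : |w ⬝ᵥ v| ≤ z ⬝ᵥ z + 2 * (v ⬝ᵥ v) := by
    have h1 := dotProduct_self_nonneg_real (z - v)
    have h2 := dotProduct_self_nonneg_real (z + v)
    have e : w ⬝ᵥ v = z ⬝ᵥ v - t * (v ⬝ᵥ v) := by simp [hw, sub_dotProduct]
    simp only [sub_dotProduct, dotProduct_sub, add_dotProduct, dotProduct_add,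
      dotProduct_comm v z] at h1 h2
    rw [e]
    have ⟨h3, h4⟩ := abs_le.1 ht
    rw [abs_le]
    constructor <;> nlinarith
  rw [abs_mul, Real.abs_exp]
  have he : Real.exp (-(w ⬝ᵥ w) / 2) ≤
      Real.exp ((v ⬝ᵥ v) / 2) * (Real.exp (-(1 / 8) * (z ⬝ᵥ z)) * Real.exp (-(1 / 8) * (z ⬝ᵥ z))) := by
    rw [← Real.exp_add, ← Real.exp_add]
    exact Real.exp_le_exp.2 (by linarith)
  have hp : |w ⬝ᵥ v| * Real.exp (-(1 / 8) * (z ⬝ᵥ z)) ≤ 8 + 2 * (v ⬝ᵥ v) := by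
    have h1 : z ⬝ᵥ z ≤ 8 * Real.exp (z ⬝ᵥ z / 8) := by
      linarith [Real.add_one_le_exp (z ⬝ᵥ z / 8)]
    have h2 : 1 ≤ Real.exp (z ⬝ᵥ z / 8) := Real.one_le_exp (by positivity)
    have h3 : Real.exp (-(1 / 8) * (z ⬝ᵥ z)) = (Real.exp (z ⬝ᵥ z / 8))⁻¹ := by
      rw [← Real.exp_neg]; congr 1; ring
    rw [h3, mul_inv_le_iff₀ (Real.exp_pos _)]
    nlinarith
  calc |w ⬝ᵥ v| * Real.exp (-(w ⬝ᵥ w) / 2)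
      ≤ |w ⬝ᵥ v| * (Real.exp ((v ⬝ᵥ v) / 2) *
        (Real.exp (-(1 / 8) * (z ⬝ᵥ z)) * Real.exp (-(1 / 8) * (z ⬝ᵥ z)))) := by gcongr
    _ = (|w ⬝ᵥ v| * Real.exp (-(1 / 8) * (z ⬝ᵥ z))) *
        (Real.exp ((v ⬝ᵥ v) / 2) * Real.exp (-(1 / 8) * (z ⬝ᵥ z))) := by ring
    _ ≤ (8 + 2 * (v ⬝ᵥ v)) * (Real.exp ((v ⬝ᵥ v) / 2) * Real.exp (-(1 / 8) * (z ⬝ᵥ z))) :=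
      mul_le_mul_of_nonneg_right hp (by positivity)
    _ = _ := by ring

/-- The first moment of the density `exp(-zᵀz/2) Φ(k + aᵀz)`, up to normalisation. -/
lemma integral_dotProduct_mul_exp_mul_stdNormalCDF (a v : ι → ℝ) (k : ℝ) :
    ∫ z, (z ⬝ᵥ v) * (Real.exp (-(z ⬝ᵥ z) / 2) * stdNormalCDF (k + a ⬝ᵥ z)) =
      Real.sqrt (2 * Real.pi) ^ Fintype.card ι *
        (gaussianPDFReal 0 1 (k / Real.sqrt (1 + a ⬝ᵥ a)) *
          ((a ⬝ᵥ v) / Real.sqrt (1 + a ⬝ᵥ a))) := by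
  set F : ℝ → (ι → ℝ) → ℝ := fun t z =>
    Real.exp (-((z - t • v) ⬝ᵥ (z - t • v)) / 2) * stdNormalCDF (k + a ⬝ᵥ z) with hF
  set s := Real.sqrt (1 + a ⬝ᵥ a)
  have hFint : ∀ t, ∫ z, F t z = Real.sqrt (2 * Real.pi) ^ Fintype.card ι *
      stdNormalCDF ((k + t * (a ⬝ᵥ v)) / s) := by
    intro t
    rw [← integral_exp_mul_stdNormalCDF a (k + t * (a ⬝ᵥ v)),
      ← integral_add_right_eq_self _ (t • v)]
    simp only [hF, add_sub_cancel_right, dotProduct_add, dotProduct_smul, smul_eq_mul]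
    congr 1 with z
    congr 2
    ring
  have h1 := (hasDerivAt_integral_of_dominated_loc_of_deriv_le (μ := volume) (F := F) (x₀ := 0)
    (F' := fun t z => ((z - t • v) ⬝ᵥ v) * Real.exp (-((z - t • v) ⬝ᵥ (z - t • v)) / 2) *
      stdNormalCDF (k + a ⬝ᵥ z))
    (bound := fun z => (8 + 2 * (v ⬝ᵥ v)) * Real.exp ((v ⬝ᵥ v) / 2) *
      Real.exp (-(1 / 8) * (z ⬝ᵥ z)))
    (Metric.closedBall_mem_nhds 0 one_pos)
    (Filter.Eventually.of_forall fun t => (by fun_prop : Continuous (F t)).aestronglyMeasurable)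
    ?_ ?_ ?_ ((integrable_exp_neg_mul_dotProduct (by norm_num)).const_mul _) ?_).2
  · have h2 : HasDerivAt (fun t => ∫ z, F t z) (Real.sqrt (2 * Real.pi) ^ Fintype.card ι *
        (gaussianPDFReal 0 1 (k / s) * ((a ⬝ᵥ v) / s))) 0 := by
      simp_rw [hFint]
      refine HasDerivAt.const_mul _ ?_
      have hl : HasDerivAt (fun t : ℝ => (k + t * (a ⬝ᵥ v)) / s) ((a ⬝ᵥ v) / s) 0 := by
        simpa using (((hasDerivAt_id (0 : ℝ)).mul_const (a ⬝ᵥ v)).const_add k).div_const s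
      have := hasDerivAt_stdNormalCDF ((k + 0 * (a ⬝ᵥ v)) / s)
      exact (this.comp 0 hl).congr_deriv (by simp)
    rw [← h1.unique h2]
    simp [mul_assoc]
  · refine ((integrable_exp_neg_mul_dotProduct (ι := ι) (b := 1 / 2) (by norm_num)).mono'
      (by fun_prop : Continuous (F 0)).aestronglyMeasurable (ae_of_all _ fun z => ?_))
    simp only [hF, zero_smul, sub_zero, Real.norm_eq_abs, abs_mul, Real.abs_exp,
      abs_of_pos (stdNormalCDF_pos _)]
    refine (mul_le_of_le_one_right (Real.exp_pos _).le (stdNormalCDF_le_one _)).trans_eq ?_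
    congr 1
    ring
  · exact (by fun_prop : Continuous fun z : ι → ℝ => ((z - (0 : ℝ) • v) ⬝ᵥ v) *
      Real.exp (-((z - (0 : ℝ) • v) ⬝ᵥ (z - (0 : ℝ) • v)) / 2) *
      stdNormalCDF (k + a ⬝ᵥ z)).aestronglyMeasurable
  · refine ae_of_all _ fun z t ht => ?_
    rw [Real.norm_eq_abs, abs_mul, abs_of_pos (stdNormalCDF_pos _)]
    exact (mul_le_of_le_one_right (abs_nonneg _) (stdNormalCDF_le_one _)).trans
      (abs_deriv_exp_neg_dotProduct_le z v (by simpa using ht))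
  · exact ae_of_all _ fun z t _ => (hasDerivAt_exp_neg_dotProduct z v t).mul_const _

variable [DecidableEq ι]

/-! ### Affine changes of variables -/

lemma map_affine_volume {M : Matrix ι ι ℝ} (hM : M.det ≠ 0) (m : ι → ℝ) :
    (volume : Measure (ι → ℝ)).map (fun z => m + M *ᵥ z) =
      ENNReal.ofReal |M.det⁻¹| • volume := by
  have h : (fun z => m + M *ᵥ z) = (fun x => m + x) ∘ Matrix.toLin' M := by
    ext; simp
  rw [h, ← Measure.map_map (by fun_prop) (by fun_prop),
    Real.map_matrix_volume_pi_eq_smul_volume_pi hM, Measure.map_smul, map_add_left_eq_self]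

lemma integral_comp_affine {M : Matrix ι ι ℝ} (hM : M.det ≠ 0) (m : ι → ℝ) {g : (ι → ℝ) → ℝ}
    (hg : Continuous g) : ∫ z, g (m + M *ᵥ z) = |M.det⁻¹| * ∫ x, g x := by
  rw [← integral_map (φ := fun z => m + M *ᵥ z) (f := g) (by fun_prop) hg.aestronglyMeasurable,
    map_affine_volume hM, integral_smul_measure, ENNReal.toReal_ofReal (abs_nonneg _), smul_eq_mul]

lemma lintegral_comp_affine {M : Matrix ι ι ℝ} (hM : M.det ≠ 0) (m : ι → ℝ) {g : (ι → ℝ) → ℝ≥0∞}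
    (hg : Measurable g) :
    ∫⁻ z, g (m + M *ᵥ z) = ENNReal.ofReal |M.det⁻¹| * ∫⁻ x, g x := by
  rw [← lintegral_map (g := fun z => m + M *ᵥ z) (f := g) hg (by fun_prop),
    map_affine_volume hM, lintegral_smul_measure, smul_eq_mul]

/-! ### Square roots of matrices -/

lemma invSqrtM_mul_invSqrtM {S : Matrix ι ι ℝ} (hS : S.PosDef) :
    invSqrtM S * invSqrtM S = S⁻¹ :=
  CFC.sqrt_mul_sqrt_self S⁻¹ (nonneg_iff_posSemidef.2 hS.inv.posSemidef)

lemma posSemidef_invSqrtM (S : Matrix ι ι ℝ) : (invSqrtM S).PosSemidef :=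
  nonneg_iff_posSemidef.1 (CFC.sqrt_nonneg _)

lemma transpose_invSqrtM (S : Matrix ι ι ℝ) : (invSqrtM S)ᵀ = invSqrtM S := by
  simpa using (posSemidef_invSqrtM S).isHermitian.eq

lemma invSqrtM_mulVec_dotProduct (S : Matrix ι ι ℝ) (x y : ι → ℝ) :
    (invSqrtM S *ᵥ x) ⬝ᵥ y = x ⬝ᵥ (invSqrtM S *ᵥ y) := by
  conv_rhs => rw [dotProduct_mulVec, ← mulVec_transpose, transpose_invSqrtM]

lemma invSqrtM_mul_mul_invSqrtM {S : Matrix ι ι ℝ} (hS : S.PosDef) :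
    invSqrtM S * S * invSqrtM S = 1 := by
  have h : invSqrtM S * (invSqrtM S * S) = 1 := by
    rw [← mul_assoc, invSqrtM_mul_invSqrtM hS, nonsing_inv_mul _ hS.det_pos.ne'.isUnit]
  exact mul_eq_one_comm.1 h

lemma det_invSqrtM_ne_zero {S : Matrix ι ι ℝ} (hS : S.PosDef) : (invSqrtM S).det ≠ 0 := by
  intro h
  have := congrArg Matrix.det (invSqrtM_mul_mul_invSqrtM hS)
  simp [h] at this

/-! ### The mean of the extended skew-normal law -/

/-- The mean of the density proportional to `exp(-u (x-m)ᵀ L (x-m) / 2) Φ(u^{1/2} ζᵀ x)`. -/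
theorem integral_dotProduct_mul_skewNormal {L : Matrix ι ι ℝ} (hL : L.PosDef) {u : ℝ} (hu : 0 < u)
    (m ζ v : ι → ℝ) :
    ∫ x, ((x - m) ⬝ᵥ v) * (Real.exp (-(u * ((x - m) ⬝ᵥ L *ᵥ (x - m))) / 2) *
        stdNormalCDF (Real.sqrt u * (ζ ⬝ᵥ x))) =
      tauIntegrand ((Real.sqrt (1 + ζ ⬝ᵥ L⁻¹ *ᵥ ζ))⁻¹ * (ζ ⬝ᵥ m)) u /
          Real.sqrt (1 + ζ ⬝ᵥ L⁻¹ *ᵥ ζ) * ((L⁻¹ *ᵥ ζ) ⬝ᵥ v) *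
        ∫ x, Real.exp (-(u * ((x - m) ⬝ᵥ L *ᵥ (x - m))) / 2) *
          stdNormalCDF (Real.sqrt u * (ζ ⬝ᵥ x)) := by
  set R := invSqrtM L with hR
  have hsu : 0 < Real.sqrt u := Real.sqrt_pos.2 hu
  set M := (Real.sqrt u)⁻¹ • R with hM
  have hdet : M.det ≠ 0 := by
    rw [hM, det_smul]
    exact mul_ne_zero (by positivity) (det_invSqrtM_ne_zero hL)
  have hq : ∀ z, u * ((M *ᵥ z) ⬝ᵥ L *ᵥ (M *ᵥ z)) = z ⬝ᵥ z := by
    intro z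
    have h1 : (R *ᵥ z) ⬝ᵥ L *ᵥ (R *ᵥ z) = z ⬝ᵥ z := by
      rw [invSqrtM_mulVec_dotProduct, mulVec_mulVec, mulVec_mulVec,
        invSqrtM_mul_mul_invSqrtM hL, one_mulVec]
    rw [hM, smul_mulVec, mulVec_smul, smul_dotProduct, dotProduct_smul, h1, smul_eq_mul,
      smul_eq_mul, ← mul_assoc, ← mul_assoc]
    have : u * (Real.sqrt u)⁻¹ * (Real.sqrt u)⁻¹ = 1 := by
      rw [mul_assoc, ← mul_inv, Real.mul_self_sqrt hu.le, mul_inv_cancel₀ hu.ne']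
    rw [this, one_mul]
  have hζ : ∀ z, Real.sqrt u * (ζ ⬝ᵥ (m + M *ᵥ z)) =
      Real.sqrt u * (ζ ⬝ᵥ m) + (R *ᵥ ζ) ⬝ᵥ z := by
    intro z
    rw [dotProduct_add, mul_add, invSqrtM_mulVec_dotProduct, hM, smul_mulVec, dotProduct_smul,
      smul_eq_mul, mul_inv_cancel_left₀ hsu.ne']
  have hRR : ∀ w, (R *ᵥ ζ) ⬝ᵥ (R *ᵥ w) = (L⁻¹ *ᵥ ζ) ⬝ᵥ w := by
    intro w
    rw [← invSqrtM_mulVec_dotProduct, mulVec_mulVec, invSqrtM_mul_invSqrtM hL]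
  have hs : (R *ᵥ ζ) ⬝ᵥ (R *ᵥ ζ) = ζ ⬝ᵥ L⁻¹ *ᵥ ζ := by rw [hRR, dotProduct_comm]
  have hK : (0 : ℝ) < |M.det⁻¹| := abs_pos.2 (inv_ne_zero hdet)
  have hden := integral_comp_affine hdet m
    (g := fun x => Real.exp (-(u * ((x - m) ⬝ᵥ L *ᵥ (x - m))) / 2) *
        stdNormalCDF (Real.sqrt u * (ζ ⬝ᵥ x))) (by fun_prop)
  have hnum := integral_comp_affine hdet m
    (g := fun x => ((x - m) ⬝ᵥ v) * (Real.exp (-(u * ((x - m) ⬝ᵥ L *ᵥ (x - m))) / 2) *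
        stdNormalCDF (Real.sqrt u * (ζ ⬝ᵥ x)))) (by fun_prop)
  simp only [add_sub_cancel_left, hq, hζ] at hden hnum
  rw [integral_exp_mul_stdNormalCDF, hs] at hden
  have hMv : ∀ z, (M *ᵥ z) ⬝ᵥ v = (Real.sqrt u)⁻¹ * (z ⬝ᵥ (R *ᵥ v)) := by
    intro z
    rw [hM, smul_mulVec, smul_dotProduct, invSqrtM_mulVec_dotProduct, smul_eq_mul]
  simp only [hMv, mul_assoc] at hnum
  rw [integral_const_mul, integral_dotProduct_mul_exp_mul_stdNormalCDF, hs, hRR] at hnum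
  refine mul_left_cancel₀ hK.ne' ?_
  rw [← hnum, mul_left_comm |M.det⁻¹|, ← hden, tauIntegrand, WPhi]
  set s := Real.sqrt (1 + ζ ⬝ᵥ L⁻¹ *ᵥ ζ)
  have e : Real.sqrt u * (s⁻¹ * (ζ ⬝ᵥ m)) = Real.sqrt u * (ζ ⬝ᵥ m) / s := by
    rw [div_eq_mul_inv]; ring
  rw [e]
  have := (stdNormalCDF_pos (Real.sqrt u * (ζ ⬝ᵥ m) / s)).ne'
  field_simp

end

/-! ### Conditional expectations of random elements with a joint density -/

section CondExp

variable {Ω β E F : Type*} [mΩ : MeasurableSpace Ω] [mβ : MeasurableSpace β] [MeasurableSpace E]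
  [NormedAddCommGroup F] [NormedSpace ℝ F]

/-- If `(X, V)` has the joint density `f` and `∫ f(x, v) h(x, v) dv = (∫ f(x, v) dv) G(x)` for
almost every `x`, then `E[h(X, V) | X] = G(X)`. -/
theorem integrable_and_condExp_ae_eq_of_map_eq_withDensity [CompleteSpace F]
    {P : Measure Ω} [IsFiniteMeasure P]
    {X : Ω → β} {V : Ω → E} (hX : Measurable X) (hV : Measurable V) {ρ : Measure β} {ν : Measure E}
    [SFinite ρ] [SFinite ν] {f : β × E → ℝ} (hf : Measurable f) (hf0 : ∀ p, 0 ≤ f p)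
    (hmap : P.map (fun ω => (X ω, V ω)) = (ρ.prod ν).withDensity fun p => ENNReal.ofReal (f p))
    {h : β × E → F} (hh : StronglyMeasurable h) (hhi : Integrable (fun ω => h (X ω, V ω)) P)
    {G : β → F} (hG : StronglyMeasurable G)
    (hfG : ∀ᵐ x ∂ρ, Integrable (fun v => f (x, v) • h (x, v)) ν →
      ∫ v, f (x, v) • h (x, v) ∂ν = (∫ v, f (x, v) ∂ν) • G x) :
    Integrable (fun ω => G (X ω)) P ∧
      P[fun ω => h (X ω, V ω) | mβ.comap X] =ᵐ[P] fun ω => G (X ω) := by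
  have hXV : Measurable fun ω => (X ω, V ω) := hX.prodMk hV
  have hfm : Measurable fun p => ENNReal.ofReal (f p) := hf.ennreal_ofReal
  have hfi : Integrable f (ρ.prod ν) := by
    refine ⟨hf.aestronglyMeasurable, ?_⟩
    rw [hasFiniteIntegral_iff_ofReal (ae_of_all _ hf0)]
    have h1 := congrArg (fun μ => μ Set.univ) hmap
    simp only [withDensity_apply _ MeasurableSet.univ, Measure.restrict_univ] at h1
    rw [← h1]
    exact measure_lt_top _ _
  have iff_int : ∀ {k : β × E → F}, Integrable k (P.map fun ω => (X ω, V ω)) ↔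
      Integrable (fun p => f p • k p) (ρ.prod ν) := by
    intro k
    rw [hmap, integrable_withDensity_iff_integrable_smul' hfm (by simp)]
    simp only [ENNReal.toReal_ofReal (hf0 _)]
  have hh1 : Integrable (fun p => f p • h p) (ρ.prod ν) :=
    iff_int.1 ((integrable_map_measure hh.aestronglyMeasurable hXV.aemeasurable).2 hhi)
  have heq : ∀ᵐ x ∂ρ, ∫ v, f (x, v) • h (x, v) ∂ν = ∫ v, f (x, v) • G x ∂ν := by
    filter_upwards [hfG, hh1.prod_right_ae] with x hx hx'
    rw [hx hx', integral_smul_const]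
  have hGm : StronglyMeasurable fun p : β × E => G p.1 := hG.comp_measurable measurable_fst
  have hG1 : Integrable (fun p : β × E => f p • G p.1) (ρ.prod ν) := by
    have hm : StronglyMeasurable fun p : β × E => f p • G p.1 := hf.stronglyMeasurable.smul hGm
    rw [integrable_prod_iff hm.aestronglyMeasurable]
    constructor
    · filter_upwards [hfi.prod_right_ae] with x hx using hx.smul_const _
    · refine hh1.integral_prod_left.norm.congr ?_
      filter_upwards [heq] with x hx
      rw [hx, integral_smul_const, norm_smul, Real.norm_of_nonneg (integral_nonneg fun v => hf0 _)]
      simp_rw [norm_smul, Real.norm_of_nonneg (hf0 _)]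
      rw [integral_mul_const]
  have hG2 : Integrable (fun ω => G (X ω)) P :=
    (integrable_map_measure hGm.aestronglyMeasurable hXV.aemeasurable).1 (iff_int.2 hG1)
  refine ⟨hG2, (ae_eq_condExp_of_forall_setIntegral_eq hX.comap_le hhi
    (fun s _ _ => hG2.integrableOn) ?_ ?_).symm⟩
  · rintro s ⟨t, ht, rfl⟩ -
    have key : ∀ {k : β × E → F}, StronglyMeasurable k → Integrable (fun p => f p • k p) (ρ.prod ν) →
        ∫ ω in X ⁻¹' t, k (X ω, V ω) ∂P = ∫ x in t, ∫ v, f (x, v) • k (x, v) ∂ν ∂ρ := by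
      intro k hk hki
      have h1 : X ⁻¹' t = (fun ω => (X ω, V ω)) ⁻¹' (t ×ˢ Set.univ) := by ext; simp
      have hms : MeasurableSet (t ×ˢ (Set.univ : Set E)) := ht.prod MeasurableSet.univ
      rw [h1, ← setIntegral_map hms hk.aestronglyMeasurable hXV.aemeasurable, hmap,
        setIntegral_withDensity_eq_setIntegral_toReal_smul hfm (by simp) _ hms]
      simp only [ENNReal.toReal_ofReal (hf0 _)]
      rw [setIntegral_prod _ hki.integrableOn]
      simp
    rw [key hGm hG1, key hh hh1]
    exact setIntegral_congr_ae ht (heq.mono fun x hx _ => hx.symm)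
  · exact (hG.comp_measurable (Measurable.of_comap_le le_rfl)).aestronglyMeasurable

end CondExp

/-! ### The minimum mean squared error predictor -/

section MSE

variable {Ω : Type*} [mΩ : MeasurableSpace Ω] {P : Measure Ω} [IsProbabilityMeasure P]

lemma lintegral_sq_eq_add_condExp {m : MeasurableSpace Ω} (hm : m ≤ mΩ) {Z : Ω → ℝ}
    (hZ : MemLp Z 2 P) :
    ∫⁻ ω, ENNReal.ofReal (Z ω ^ 2) ∂P =
      ∫⁻ ω, ENNReal.ofReal ((Z ω - P[Z | m] ω) ^ 2) ∂P +
        ∫⁻ ω, ENNReal.ofReal (P[Z | m] ω ^ 2) ∂P := by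
  have hE : MemLp (P[Z | m]) 2 P := hZ.condExp one_le_two
  have hZE : Integrable (fun ω => (Z ω - P[Z | m] ω) ^ 2) P := (hZ.sub hE).integrable_sq
  have h1 := integral_condVar_add_variance_condExp hm hZ
  rw [condVar, integral_condExp hm, variance_eq_sub hE, variance_eq_sub hZ, integral_condExp hm] at h1
  rw [← ofReal_integral_eq_lintegral_ofReal hZ.integrable_sq (ae_of_all _ fun _ => sq_nonneg _),
    ← ofReal_integral_eq_lintegral_ofReal hZE (ae_of_all _ fun _ => sq_nonneg _),
    ← ofReal_integral_eq_lintegral_ofReal hE.integrable_sq (ae_of_all _ fun _ => sq_nonneg _),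
    ← ENNReal.ofReal_add (integral_nonneg fun _ => sq_nonneg _)
      (integral_nonneg fun _ => sq_nonneg _)]
  congr 1
  simp only [Pi.pow_apply, Pi.sub_apply] at h1 ⊢
  linarith

variable {q : ℕ} {β : Type*} [mβ : MeasurableSpace β] {V : Ω → Fin q → ℝ}

lemma measurable_condMean (V : Ω → Fin q → ℝ) (Y : Ω → β) : Measurable (condMean P V Y) :=
  (StronglyMeasurable.integral_condDistrib (f := fun p : β × (Fin q → ℝ) => p.2)
    measurable_snd.stronglyMeasurable).measurable

lemma ae_integrable_condDistrib {Y : Ω → β} (hY : Measurable Y) (hV : Integrable V P) :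
    ∀ᵐ y ∂(P.map Y), Integrable (fun v : Fin q → ℝ => v) (condDistrib V Y P y) := by
  refine Integrable.condDistrib_ae_map (f := fun p : β × (Fin q → ℝ) => p.2)
    hV.aestronglyMeasurable.aemeasurable ?_
  rwa [integrable_map_measure measurable_snd.aestronglyMeasurable
    (hY.aemeasurable.prodMk hV.aestronglyMeasurable.aemeasurable)]

lemma condExp_ae_eq_condMean {Y : Ω → β} (hY : Measurable Y) (hV : Integrable V P) :
    P[V | mβ.comap Y] =ᵐ[P] fun ω => condMean P V Y (Y ω) :=
  condExp_ae_eq_integral_condDistrib' hY hV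

lemma condExp_apply_ae_eq_condMean {Y : Ω → β} (hY : Measurable Y) (hV : Integrable V P)
    (j : Fin q) :
    P[fun ω => V ω j | mβ.comap Y] =ᵐ[P] fun ω => condMean P V Y (Y ω) j := by
  have h := condExp_ae_eq_integral_condDistrib (μ := P) hY hV.aestronglyMeasurable.aemeasurable
    (f := fun v : Fin q → ℝ => v j) (measurable_pi_apply j).stronglyMeasurable (hV.eval j)
  filter_upwards [h, ae_of_ae_map hY.aemeasurable (ae_integrable_condDistrib hY hV)] with ω h1 h2
  rw [h1, condMean, eval_integral fun i => h2.eval i]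

/-- The conditional mean of an integrable random vector is its minimum mean squared error
predictor. -/
theorem isMinMSEPredictor_condMean {k : ℕ} {Y : Ω → Fin k → ℝ} (hY : Measurable Y)
    (hVm : Measurable V) (hV : Integrable V P) : IsMinMSEPredictor P V Y (condMean P V Y) := by
  have hg := measurable_condMean (P := P) V Y
  refine ⟨hg, fun h hh => ?_⟩
  set g := condMean P V Y
  have hsum : ∀ w : (Fin k → ℝ) → Fin q → ℝ, Measurable w →
      mse P V Y w = ∑ j, ∫⁻ ω, ENNReal.ofReal ((V ω j - w (Y ω) j) ^ 2) ∂P := by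
    intro w hw
    rw [mse, ← lintegral_finsetSum _ fun j _ => by fun_prop]
    congr 1 with ω
    exact ENNReal.ofReal_sum_of_nonneg fun j _ => sq_nonneg _
  have hdecomp : mse P V Y h ≠ ∞ → mse P V Y h =
      mse P V Y g + ∑ j, ∫⁻ ω, ENNReal.ofReal ((g (Y ω) j - h (Y ω) j) ^ 2) ∂P := by
    intro hfin
    rw [hsum h hh, hsum g hg, ← Finset.sum_add_distrib]
    rw [hsum h hh] at hfin
    refine Finset.sum_congr rfl fun j hj => ?_
    have hZm : Measurable fun ω => V ω j - h (Y ω) j := by fun_prop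
    have hZ : MemLp (fun ω => V ω j - h (Y ω) j) 2 P := by
      rw [memLp_two_iff_integrable_sq hZm.aestronglyMeasurable]
      refine ⟨(hZm.pow_const 2).aestronglyMeasurable, ?_⟩
      rw [hasFiniteIntegral_iff_ofReal (ae_of_all _ fun _ => sq_nonneg _)]
      exact (ENNReal.sum_ne_top.1 hfin j hj).lt_top
    have hVj : Integrable (fun ω => V ω j) P := hV.eval j
    have hhj : Integrable (fun ω => h (Y ω) j) P :=
      (hVj.sub (hZ.integrable one_le_two)).congr (ae_of_all _ fun ω => by simp)
    have hcond : P[fun ω => V ω j - h (Y ω) j | MeasurableSpace.comap Y inferInstance] =ᵐ[P]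
        fun ω => g (Y ω) j - h (Y ω) j := by
      have hs : StronglyMeasurable[MeasurableSpace.comap Y inferInstance] fun ω => h (Y ω) j :=
        (((measurable_pi_apply j).comp hh).comp
          (Measurable.of_comap_le le_rfl)).stronglyMeasurable
      filter_upwards [condExp_sub hVj hhj (MeasurableSpace.comap Y inferInstance),
        condExp_apply_ae_eq_condMean hY hV j] with ω h1 h2
      have h3 := congrFun (condExp_of_stronglyMeasurable hY.comap_le hs hhj) ω
      refine h1.trans ?_
      rw [Pi.sub_apply, h2, h3]
    rw [lintegral_sq_eq_add_condExp hY.comap_le hZ]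
    congr 1
    · refine lintegral_congr_ae ?_
      filter_upwards [hcond] with ω hω
      rw [hω, sub_sub_sub_cancel_right]
    · refine lintegral_congr_ae ?_
      filter_upwards [hcond] with ω hω
      rw [hω]
  constructor
  · by_cases hfin : mse P V Y h = ∞
    · rw [hfin]; exact le_top
    · rw [hdecomp hfin]; exact le_self_add
  · intro hgfin heq
    have h0 := hdecomp (heq ▸ hgfin)
    rw [heq] at h0
    have h1 := (ENNReal.add_right_inj hgfin).1 (h0.symm.trans (add_zero _).symm)
    rw [Finset.sum_eq_zero_iff] at h1
    rw [Filter.EventuallyEq, ae_map_iff hY.aemeasurable (measurableSet_eq_fun hh hg)]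
    have h2 : ∀ j, ∀ᵐ ω ∂P, g (Y ω) j - h (Y ω) j = 0 := by
      intro j
      have h3 := (lintegral_eq_zero_iff (by fun_prop)).1 (h1 j (Finset.mem_univ j))
      filter_upwards [h3] with ω hω
      have h4 : (g (Y ω) j - h (Y ω) j) ^ 2 ≤ 0 := ENNReal.ofReal_eq_zero.1 hω
      exact pow_eq_zero_iff two_ne_zero |>.1 (le_antisymm h4 (sq_nonneg _))
    filter_upwards [ae_all_iff.2 h2] with ω hω
    ext j
    exact (sub_eq_zero.1 (hω j)).symm

end MSE

/-! ### Block matrices and completing the square -/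

section Matrices

variable {ι κ : Type*} [Fintype ι] [DecidableEq ι] [Fintype κ] [DecidableEq κ]

lemma posSemidef_fromBlocks_diagonal {ι κ : Type*} [Fintype ι] [Fintype κ]
    {A : Matrix ι ι ℝ} {B : Matrix κ κ ℝ} (hA : A.PosSemidef)
    (hB : B.PosSemidef) : (fromBlocks A 0 0 B).PosSemidef := by
  refine PosSemidef.of_dotProduct_mulVec_nonneg ?_ fun x => ?_
  · rw [IsHermitian, fromBlocks_conjTranspose, hA.isHermitian.eq, hB.isHermitian.eq]
    simp
  · obtain ⟨y, z, rfl⟩ : ∃ y z, x = Sum.elim y z := ⟨_, _, (Sum.elim_comp_inl_inr x).symm⟩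
    have h1 := hA.dotProduct_mulVec_nonneg y
    have h2 := hB.dotProduct_mulVec_nonneg z
    simp only [star_trivial] at h1 h2 ⊢
    simpa [fromBlocks_mulVec, sumElim_dotProduct_sumElim] using add_nonneg h1 h2

lemma inv_fromBlocks_diagonal {A : Matrix ι ι ℝ} {B : Matrix κ κ ℝ} (hA : A.PosDef)
    (hB : B.PosDef) : (fromBlocks A 0 0 B)⁻¹ = fromBlocks A⁻¹ 0 0 B⁻¹ := by
  refine inv_eq_right_inv ?_
  rw [fromBlocks_multiply]
  simp [mul_nonsing_inv _ hA.det_pos.ne'.isUnit, mul_nonsing_inv _ hB.det_pos.ne'.isUnit]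

lemma posDef_fromBlocks_diagonal {A : Matrix ι ι ℝ} {B : Matrix κ κ ℝ} (hA : A.PosDef)
    (hB : B.PosDef) : (fromBlocks A 0 0 B).PosDef := by
  refine (posSemidef_fromBlocks_diagonal hA.posSemidef hB.posSemidef).posDef_iff_isUnit.2 ?_
  rw [isUnit_iff_isUnit_det, det_fromBlocks_zero₂₁]
  exact (mul_pos hA.det_pos hB.det_pos).ne'.isUnit

lemma invSqrtM_fromBlocks_diagonal {A : Matrix ι ι ℝ} {B : Matrix κ κ ℝ} (hA : A.PosDef)
    (hB : B.PosDef) :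
    invSqrtM (fromBlocks A 0 0 B) = fromBlocks (invSqrtM A) 0 0 (invSqrtM B) := by
  refine CFC.sqrt_unique ?_ (nonneg_iff_posSemidef.2
    (posSemidef_fromBlocks_diagonal (posSemidef_invSqrtM A) (posSemidef_invSqrtM B)))
  rw [fromBlocks_multiply, inv_fromBlocks_diagonal hA hB]
  simp [invSqrtM_mul_invSqrtM hA, invSqrtM_mul_invSqrtM hB]

lemma dotProduct_mulVec_comm_of_isHermitian {ι : Type*} [Fintype ι] {A : Matrix ι ι ℝ} (hA : A.IsHermitian)
    (x y : ι → ℝ) : x ⬝ᵥ A *ᵥ y = y ⬝ᵥ A *ᵥ x := by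
  have h : Aᵀ = A := by simpa using hA.eq
  rw [dotProduct_mulVec, ← mulVec_transpose, h, dotProduct_comm]

/-- Completing the square in a Gaussian linear model. -/
lemma quadratic_add_quadratic_eq {ι κ : Type*} [Fintype ι] [Fintype κ]
    {A : Matrix ι ι ℝ} {B : Matrix κ κ ℝ} (hA : A.IsHermitian)
    (hB : B.IsHermitian) (Z : Matrix κ ι ℝ) (d : κ → ℝ) (x m : ι → ℝ)
    (hm : (A + Zᵀ * B * Z) *ᵥ m = (Zᵀ * B) *ᵥ d) :
    x ⬝ᵥ A *ᵥ x + (d - Z *ᵥ x) ⬝ᵥ B *ᵥ (d - Z *ᵥ x) =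
      (x - m) ⬝ᵥ (A + Zᵀ * B * Z) *ᵥ (x - m) +
        (d ⬝ᵥ B *ᵥ d - m ⬝ᵥ (A + Zᵀ * B * Z) *ᵥ m) := by
  have hL : (A + Zᵀ * B * Z).IsHermitian := by
    refine hA.add ?_
    simpa using isHermitian_conjTranspose_mul_mul Z hB
  have hZ : ∀ (y : ι → ℝ) (w : κ → ℝ), (Z *ᵥ y) ⬝ᵥ w = y ⬝ᵥ Zᵀ *ᵥ w := by
    intro y w
    rw [mulVec_transpose, dotProduct_comm, dotProduct_mulVec, dotProduct_comm]
  have h1 : x ⬝ᵥ (A + Zᵀ * B * Z) *ᵥ x = x ⬝ᵥ A *ᵥ x + (Z *ᵥ x) ⬝ᵥ B *ᵥ (Z *ᵥ x) := by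
    rw [add_mulVec, dotProduct_add, hZ, mulVec_mulVec, mulVec_mulVec]
  have h2 : (Z *ᵥ x) ⬝ᵥ B *ᵥ d = x ⬝ᵥ (A + Zᵀ * B * Z) *ᵥ m := by
    rw [hm, hZ, mulVec_mulVec]
  simp only [mulVec_sub, sub_dotProduct, dotProduct_sub]
  rw [dotProduct_mulVec_comm_of_isHermitian hL m x, h1, ← h2,
    dotProduct_mulVec_comm_of_isHermitian hB d (Z *ᵥ x)]
  ring

/-- `(D⁻¹ + Zᵀ Σ⁻¹ Z) D Zᵀ (Σ + Z D Zᵀ)⁻¹ = Zᵀ Σ⁻¹`. -/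
lemma inv_add_mul_mul_transpose_mul_inv {D : Matrix ι ι ℝ} {S : Matrix κ κ ℝ} {Z : Matrix κ ι ℝ}
    (hD : D.PosDef) (hS : S.PosDef) (hPsi : (S + Z * D * Zᵀ).PosDef) :
    (D⁻¹ + Zᵀ * S⁻¹ * Z) * (D * Zᵀ * (S + Z * D * Zᵀ)⁻¹) = Zᵀ * S⁻¹ := by
  have h1 : D⁻¹ * D = 1 := nonsing_inv_mul _ hD.det_pos.ne'.isUnit
  have h2 : S⁻¹ * S = 1 := nonsing_inv_mul _ hS.det_pos.ne'.isUnit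
  have h3 : (D⁻¹ + Zᵀ * S⁻¹ * Z) * (D * Zᵀ) = Zᵀ * S⁻¹ * (S + Z * D * Zᵀ) := by
    rw [Matrix.add_mul, Matrix.mul_add, ← Matrix.mul_assoc D⁻¹, h1, Matrix.mul_assoc Zᵀ S⁻¹ S, h2,
      Matrix.one_mul, Matrix.mul_one]
    simp only [Matrix.mul_assoc]
  rw [← Matrix.mul_assoc, h3, Matrix.mul_assoc, mul_nonsing_inv _ hPsi.det_pos.ne'.isUnit,
    Matrix.mul_one]

end Matrices

/-! ### The joint density of a scale mixture of skew-normal laws -/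

section Density

variable {ι : Type*} [Fintype ι] [DecidableEq ι]

lemma scaledSkewNormalPDF_eq {u : ℝ} (hu : 0 < u) {S : Matrix ι ι ℝ} (hS : S.PosDef)
    (μ lam w : ι → ℝ) :
    scaledSkewNormalPDF μ S lam u w =
      2 * (Real.sqrt ((2 * Real.pi) ^ Fintype.card ι * S.det))⁻¹ *
        Real.sqrt u ^ Fintype.card ι *
        (Real.exp (-(u * ((w - μ) ⬝ᵥ S⁻¹ *ᵥ (w - μ))) / 2) *
          stdNormalCDF (Real.sqrt u * (lam ⬝ᵥ invSqrtM S *ᵥ (w - μ)))) := by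
  have hinv : (u⁻¹ • S)⁻¹ = u • S⁻¹ := by
    refine inv_eq_right_inv ?_
    rw [smul_mul_smul_comm, inv_mul_cancel₀ hu.ne', mul_nonsing_inv _ hS.det_pos.ne'.isUnit,
      one_smul]
  have hdet : Real.sqrt ((2 * Real.pi) ^ Fintype.card ι * (u⁻¹ • S).det) =
      (Real.sqrt u ^ Fintype.card ι)⁻¹ *
        Real.sqrt ((2 * Real.pi) ^ Fintype.card ι * S.det) := by
    have hpow : Real.sqrt (u ^ Fintype.card ι) = Real.sqrt u ^ Fintype.card ι := by
      rw [Real.sqrt_eq_iff_mul_self_eq (by positivity) (by positivity), ← mul_pow,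
        Real.mul_self_sqrt hu.le]
    rw [det_smul, mul_left_comm, Real.sqrt_mul (by positivity), inv_pow, Real.sqrt_inv, hpow]
  rw [scaledSkewNormalPDF, normalPDF, hdet, hinv, smul_mulVec, dotProduct_smul, smul_eq_mul,
    mul_inv, inv_inv]
  ring

lemma integrable_one_add_abs_dotProduct_mul_exp {ι : Type*} [Fintype ι] (v : ι → ℝ) :
    Integrable fun z : ι → ℝ => (1 + |z ⬝ᵥ v|) * Real.exp (-(z ⬝ᵥ z) / 2) := by
  have h1 : Integrable fun z : ι → ℝ => Real.exp (-(z ⬝ᵥ z) / 2) := by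
    refine (integrable_exp_neg_mul_dotProduct (ι := ι) (b := 1 / 2) (by norm_num)).congr
      (ae_of_all _ fun z => ?_)
    simp only
    congr 1
    ring
  have h2 : Integrable fun z : ι → ℝ => |z ⬝ᵥ v| * Real.exp (-(z ⬝ᵥ z) / 2) := by
    refine ((integrable_exp_neg_mul_dotProduct (ι := ι) (b := 1 / 8) (by norm_num)).const_mul
      ((8 + 2 * (v ⬝ᵥ v)) * Real.exp ((v ⬝ᵥ v) / 2))).mono'
      (by fun_prop : Continuous fun z : ι → ℝ =>
        |z ⬝ᵥ v| * Real.exp (-(z ⬝ᵥ z) / 2)).aestronglyMeasurable (ae_of_all _ fun z => ?_)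
    simpa [abs_mul] using abs_deriv_exp_neg_dotProduct_le z v (t := 0) (by simp)
  refine (h1.add h2).congr (ae_of_all _ fun z => ?_)
  simp [add_mul]

lemma lintegral_one_add_abs_dotProduct_mul_exp_lt_top {S : Matrix ι ι ℝ} (hS : S.PosDef)
    (v : ι → ℝ) :
    ∫⁻ z, ENNReal.ofReal ((1 + |z ⬝ᵥ v|) * Real.exp (-(z ⬝ᵥ S⁻¹ *ᵥ z) / 2)) < ∞ := by
  set R := invSqrtM S⁻¹
  have hdet : R.det ≠ 0 := det_invSqrtM_ne_zero hS.inv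
  have h := lintegral_comp_affine hdet 0 (g := fun z => ENNReal.ofReal
    ((1 + |z ⬝ᵥ v|) * Real.exp (-(z ⬝ᵥ S⁻¹ *ᵥ z) / 2)))
    (by fun_prop : Continuous fun z : ι → ℝ =>
      (1 + |z ⬝ᵥ v|) * Real.exp (-(z ⬝ᵥ S⁻¹ *ᵥ z) / 2)).measurable.ennreal_ofReal
  have hq : ∀ z, (R *ᵥ z) ⬝ᵥ S⁻¹ *ᵥ (R *ᵥ z) = z ⬝ᵥ z := by
    intro z
    rw [invSqrtM_mulVec_dotProduct, mulVec_mulVec, mulVec_mulVec,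
      invSqrtM_mul_mul_invSqrtM hS.inv, one_mulVec]
  simp only [zero_add, hq, R, invSqrtM_mulVec_dotProduct] at h
  have hfin := (integrable_one_add_abs_dotProduct_mul_exp (invSqrtM S⁻¹ *ᵥ v)).lintegral_lt_top
  rw [h] at hfin
  refine lt_top_iff_ne_top.2 fun htop => ?_
  rw [htop, ENNReal.mul_top (by simpa using hdet)] at hfin
  exact lt_irrefl _ hfin

variable {Ω : Type*} [MeasurableSpace Ω] {P : Measure Ω} {U : Ω → ℝ} {W : Ω → ι → ℝ}
  {μ lam : ι → ℝ} {S : Matrix ι ι ℝ} {H : Measure ℝ}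

lemma ae_pos_of_measure_Iic_eq_zero (hH : H (Set.Iic 0) = 0) : ∀ᵐ u ∂H, 0 < u := by
  rw [ae_iff]
  simpa [Set.Iic] using hH

lemma IsSMSN.map_eq_withDensity [SFinite H] (h : IsSMSN P U W μ S lam H) (hS : S.PosDef)
    (hH : H (Set.Iic 0) = 0) :
    P.map (fun ω => (U ω, W ω)) = (H.prod volume).withDensity fun p => ENNReal.ofReal
      (2 * (Real.sqrt ((2 * Real.pi) ^ Fintype.card ι * S.det))⁻¹ *
        Real.sqrt p.1 ^ Fintype.card ι *
        (Real.exp (-(p.1 * ((p.2 - μ) ⬝ᵥ S⁻¹ *ᵥ (p.2 - μ))) / 2) *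
          stdNormalCDF (Real.sqrt p.1 * (lam ⬝ᵥ invSqrtM S *ᵥ (p.2 - μ))))) := by
  rw [show P.map (fun ω => (U ω, W ω)) = _ from h]
  refine withDensity_congr_ae ?_
  filter_upwards [Measure.quasiMeasurePreserving_fst.ae (ae_pos_of_measure_Iic_eq_zero hH)]
    with p hp
  rw [scaledSkewNormalPDF_eq hp hS]

lemma continuous_skewNormal_density (c : ℝ) (μ lam : ι → ℝ) (S : Matrix ι ι ℝ) :
    Continuous fun p : ℝ × (ι → ℝ) => c *
        Real.sqrt p.1 ^ Fintype.card ι *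
        (Real.exp (-(p.1 * ((p.2 - μ) ⬝ᵥ S⁻¹ *ᵥ (p.2 - μ))) / 2) *
          stdNormalCDF (Real.sqrt p.1 * (lam ⬝ᵥ invSqrtM S *ᵥ (p.2 - μ)))) := by
  fun_prop

lemma IsSMSN.integrable_inv_sqrt_add_abs_dotProduct [IsProbabilityMeasure H]
    (h : IsSMSN P U W μ S lam H) (hS : S.PosDef)
    (hH : H (Set.Iic 0) = 0) (hk : Integrable (fun u => (Real.sqrt u)⁻¹) H)
    (hU : Measurable U) (hW : Measurable W) (v : ι → ℝ) :
    Integrable (fun ω => (Real.sqrt (U ω))⁻¹ + |(W ω - μ) ⬝ᵥ v|) P := by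
  set g : ℝ × (ι → ℝ) → ℝ := fun p => (Real.sqrt p.1)⁻¹ + |(p.2 - μ) ⬝ᵥ v| with hg
  have hgm : Measurable g :=
    (Real.continuous_sqrt.measurable.comp measurable_fst).inv.add
      (by fun_prop : Continuous fun p : ℝ × (ι → ℝ) => |(p.2 - μ) ⬝ᵥ v|).measurable
  have hg0 : ∀ p, 0 ≤ g p := fun p => add_nonneg (by positivity) (abs_nonneg _)
  suffices hs : Integrable g (P.map fun ω => (U ω, W ω)) from
    (integrable_map_measure hgm.aestronglyMeasurable (hU.prodMk hW).aemeasurable).1 hs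
  refine ⟨hgm.aestronglyMeasurable, ?_⟩
  rw [hasFiniteIntegral_iff_ofReal (ae_of_all _ hg0), h.map_eq_withDensity hS hH]
  set C := 2 * (Real.sqrt ((2 * Real.pi) ^ Fintype.card ι * S.det))⁻¹ with hC
  have hC0 : 0 ≤ C := by positivity
  have hdm := (continuous_skewNormal_density C μ lam S).measurable.ennreal_ofReal
  rw [lintegral_withDensity_eq_lintegral_mul _ hdm hgm.ennreal_ofReal,
    lintegral_prod _ (hdm.mul hgm.ennreal_ofReal).aemeasurable]
  set K := ∫⁻ z, ENNReal.ofReal ((1 + |z ⬝ᵥ v|) * Real.exp (-(z ⬝ᵥ S⁻¹ *ᵥ z) / 2)) with hK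
  have hKfin : K < ∞ := lintegral_one_add_abs_dotProduct_mul_exp_lt_top hS v
  have hbound : ∀ᵐ u ∂H, ∫⁻ w, ENNReal.ofReal (C * Real.sqrt u ^ Fintype.card ι *
        (Real.exp (-(u * ((w - μ) ⬝ᵥ S⁻¹ *ᵥ (w - μ))) / 2) *
          stdNormalCDF (Real.sqrt u * (lam ⬝ᵥ invSqrtM S *ᵥ (w - μ))))) *
        ENNReal.ofReal (g (u, w)) ≤ ENNReal.ofReal C * K * ENNReal.ofReal (Real.sqrt u)⁻¹ := by
    filter_upwards [ae_pos_of_measure_Iic_eq_zero hH] with u hu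
    have hsu : 0 < Real.sqrt u := Real.sqrt_pos.2 hu
    have hdet : (Real.sqrt u • (1 : Matrix ι ι ℝ)).det = Real.sqrt u ^ Fintype.card ι := by
      rw [det_smul, det_one, mul_one]
    have haff := lintegral_comp_affine (M := Real.sqrt u • (1 : Matrix ι ι ℝ))
      (by rw [hdet]; positivity) (-(Real.sqrt u • μ))
      (g := fun z => ENNReal.ofReal ((1 + |z ⬝ᵥ v|) * Real.exp (-(z ⬝ᵥ S⁻¹ *ᵥ z) / 2)))
      (by fun_prop : Continuous fun z : ι → ℝ =>
        (1 + |z ⬝ᵥ v|) * Real.exp (-(z ⬝ᵥ S⁻¹ *ᵥ z) / 2)).measurable.ennreal_ofReal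
    rw [hdet, ← hK] at haff
    have hz : ∀ w : ι → ℝ, -(Real.sqrt u • μ) + (Real.sqrt u • (1 : Matrix ι ι ℝ)) *ᵥ w =
        Real.sqrt u • (w - μ) := by
      intro w
      rw [smul_mulVec, one_mulVec, smul_sub]
      abel
    simp only [hz] at haff
    have hle : ∀ w, ENNReal.ofReal (C * Real.sqrt u ^ Fintype.card ι *
        (Real.exp (-(u * ((w - μ) ⬝ᵥ S⁻¹ *ᵥ (w - μ))) / 2) *
          stdNormalCDF (Real.sqrt u * (lam ⬝ᵥ invSqrtM S *ᵥ (w - μ))))) *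
        ENNReal.ofReal (g (u, w)) ≤
        ENNReal.ofReal (C * Real.sqrt u ^ Fintype.card ι * (Real.sqrt u)⁻¹) *
        ENNReal.ofReal ((1 + |(Real.sqrt u • (w - μ)) ⬝ᵥ v|) *
          Real.exp (-((Real.sqrt u • (w - μ)) ⬝ᵥ S⁻¹ *ᵥ (Real.sqrt u • (w - μ))) / 2)) := by
      intro w
      have hq : (Real.sqrt u • (w - μ)) ⬝ᵥ S⁻¹ *ᵥ (Real.sqrt u • (w - μ)) =
          u * ((w - μ) ⬝ᵥ S⁻¹ *ᵥ (w - μ)) := by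
        rw [mulVec_smul, smul_dotProduct, dotProduct_smul, smul_eq_mul, smul_eq_mul, ← mul_assoc,
          Real.mul_self_sqrt hu.le]
      have hgu : g (u, w) = (Real.sqrt u)⁻¹ * (1 + |(Real.sqrt u • (w - μ)) ⬝ᵥ v|) := by
        simp only [hg]
        rw [smul_dotProduct, smul_eq_mul, abs_mul, abs_of_pos hsu, mul_add, mul_one,
          inv_mul_cancel_left₀ hsu.ne']
      rw [hq, hgu, ← ENNReal.ofReal_mul (mul_nonneg (by positivity)
        (mul_nonneg (Real.exp_pos _).le (stdNormalCDF_pos _).le)),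
        ← ENNReal.ofReal_mul (by positivity)]
      refine ENNReal.ofReal_le_ofReal ?_
      have h1 := stdNormalCDF_le_one (Real.sqrt u * (lam ⬝ᵥ invSqrtM S *ᵥ (w - μ)))
      set E := Real.exp (-(u * ((w - μ) ⬝ᵥ S⁻¹ *ᵥ (w - μ))) / 2)
      calc _ ≤ C * Real.sqrt u ^ Fintype.card ι * (E * 1) *
            ((Real.sqrt u)⁻¹ * (1 + |(Real.sqrt u • (w - μ)) ⬝ᵥ v|)) := by gcongr
        _ = _ := by ring
    refine (lintegral_mono hle).trans ?_
    rw [lintegral_const_mul' _ _ ENNReal.ofReal_ne_top, haff, abs_of_pos (by positivity),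
      ← mul_assoc, ← ENNReal.ofReal_mul (by positivity), mul_right_comm (ENNReal.ofReal C),
      ← ENNReal.ofReal_mul hC0]
    refine le_of_eq ?_
    congr 2
    field_simp
  refine (lintegral_mono_ae hbound).trans_lt ?_
  rw [lintegral_const_mul' _ _ (ENNReal.mul_ne_top ENNReal.ofReal_ne_top hKfin.ne)]
  exact ENNReal.mul_lt_top (ENNReal.mul_lt_top ENNReal.ofReal_lt_top hKfin) hk.lintegral_lt_top

lemma IsSMSN.integrable_inv_sqrt [IsProbabilityMeasure H]
    (h : IsSMSN P U W μ S lam H) (hS : S.PosDef)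
    (hH : H (Set.Iic 0) = 0) (hk : Integrable (fun u => (Real.sqrt u)⁻¹) H)
    (hU : Measurable U) (hW : Measurable W) :
    Integrable (fun ω => (Real.sqrt (U ω))⁻¹) P := by
  simpa using h.integrable_inv_sqrt_add_abs_dotProduct hS hH hk hU hW 0

lemma IsSMSN.integrable [IsProbabilityMeasure H] [IsFiniteMeasure P]
    (h : IsSMSN P U W μ S lam H) (hS : S.PosDef)
    (hH : H (Set.Iic 0) = 0) (hk : Integrable (fun u => (Real.sqrt u)⁻¹) H)
    (hU : Measurable U) (hW : Measurable W) : Integrable W P := by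
  refine Integrable.of_eval fun j => ?_
  have h1 := h.integrable_inv_sqrt_add_abs_dotProduct hS hH hk hU hW (Pi.single j 1)
  have h2 : Integrable (fun ω => W ω j - μ j) P := by
    refine h1.mono' (by fun_prop) (ae_of_all _ fun ω => ?_)
    simp
  exact (h2.add (integrable_const (μ j))).congr (ae_of_all _ fun ω => by simp)

/-- The joint law of the mixing factor, the response and the random effects in a linear mixed
model. -/
lemma map_eq_withDensity_of_linear_response {ι κ : Type*} [Fintype ι] [Fintype κ] {H : Measure ℝ} [SFinite H]
    {b : Ω → ι → ℝ} {e Y : Ω → κ → ℝ}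
    (hU : Measurable U) (hb : Measurable b) (he : Measurable e) (a : κ → ℝ) (Z : Matrix κ ι ℝ)
    (hY : ∀ ω, Y ω = a + Z *ᵥ b ω + e ω) {f : ℝ × (ι ⊕ κ → ℝ) → ℝ≥0∞} (hf : Measurable f)
    (hmap : P.map (fun ω => (U ω, Sum.elim (b ω) (e ω))) = (H.prod volume).withDensity f) :
    P.map (fun ω => ((U ω, Y ω), b ω)) =
      ((H.prod volume).prod volume).withDensity
        fun p => f (p.1.1, Sum.elim p.2 (p.1.2 - a - Z *ᵥ p.2)) := by
  set g : (ℝ × (κ → ℝ)) × (ι → ℝ) → ℝ≥0∞ :=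
    fun p => f (p.1.1, Sum.elim p.2 (p.1.2 - a - Z *ᵥ p.2)) with hg
  have helim : Continuous fun p : (ι → ℝ) × (κ → ℝ) => Sum.elim p.1 p.2 := by
    refine continuous_pi fun j => ?_
    cases j <;> simp only [Sum.elim_inl, Sum.elim_inr] <;> fun_prop
  have hgm : Measurable g := hf.comp (measurable_fst.fst.prodMk
    (helim.comp (by fun_prop : Continuous fun p : (ℝ × (κ → ℝ)) × (ι → ℝ) =>
      (p.2, p.1.2 - a - Z *ᵥ p.2))).measurable)
  have hshear : MeasurePreserving (fun p : (ι → ℝ) × (κ → ℝ) => (p.1, a + Z *ᵥ p.1 + p.2))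
      (volume.prod volume) (volume.prod volume) :=
    (MeasurePreserving.id volume).skew_product (g := fun x y => a + Z *ᵥ x + y)
      (by fun_prop : Continuous fun p : (ι → ℝ) × (κ → ℝ) => a + Z *ᵥ p.1 + p.2).measurable
      (ae_of_all _ fun x => map_add_left_eq_self _ _)
  have hassoc : MeasurePreserving
      (MeasurableEquiv.prodAssoc (α := ℝ) (β := κ → ℝ) (γ := ι → ℝ)).symm
      (H.prod (volume.prod volume)) ((H.prod volume).prod volume) :=
    MeasurePreserving.symm _ ⟨MeasurableEquiv.measurable _, Measure.prodAssoc_prod⟩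
  have hF := hassoc.comp ((MeasurePreserving.id H).prod
    ((Measure.measurePreserving_swap.comp hshear).comp
      (volume_measurePreserving_sumPiEquivProdPi fun _ : ι ⊕ κ => ℝ)))
  set F := (MeasurableEquiv.prodAssoc (α := ℝ) (β := κ → ℝ) (γ := ι → ℝ)).symm ∘
    Prod.map id ((Prod.swap ∘ fun p : (ι → ℝ) × (κ → ℝ) => (p.1, a + Z *ᵥ p.1 + p.2)) ∘
      MeasurableEquiv.sumPiEquivProdPi fun _ : ι ⊕ κ => ℝ)
  have hFapp : ∀ u (x : ι → ℝ) (y : κ → ℝ), F (u, Sum.elim x y) = ((u, a + Z *ᵥ x + y), x) :=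
    fun u x y => rfl
  have hgF : ∀ p, g (F p) = f p := by
    rintro ⟨u, w⟩
    rw [← Sum.elim_comp_inl_inr w, hFapp, hg]
    simp only
    congr 3
    abel
  have hcomp : (fun ω => ((U ω, Y ω), b ω)) = F ∘ fun ω => (U ω, Sum.elim (b ω) (e ω)) := by
    ext1 ω
    rw [Function.comp_apply, hFapp, hY]
  have hUW : Measurable fun ω => (U ω, Sum.elim (b ω) (e ω)) :=
    hU.prodMk (helim.measurable.comp (hb.prodMk he))
  rw [hcomp, ← Measure.map_map hF.measurable hUW, hmap]
  ext s hs
  rw [Measure.map_apply hF.measurable hs, withDensity_apply _ (hF.measurable hs),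
    withDensity_apply _ hs, ← hF.setLIntegral_comp_preimage hs hgm]
  simp only [hgF]

end Density

/-! ### The conditional mean of the random effects -/

namespace Params

variable {n q l : ℕ} {m : Fin n → ℕ} (M : Params n q l m) (i : Fin n)

lemma posDef_Psi : (M.Psi i).PosDef := by
  refine (M.posDef_Sig i).add_posSemidef ?_
  simpa using M.posDef_D.posSemidef.mul_mul_conjTranspose_same (M.Z i)

lemma posDef_precision : (M.D⁻¹ + (M.Z i)ᵀ * (M.Sig i)⁻¹ * M.Z i).PosDef := by
  refine M.posDef_D.inv.add_posSemidef ?_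
  simpa using (M.posDef_Sig i).inv.posSemidef.conjTranspose_mul_mul_same (M.Z i)

lemma precision_mulVec_muB_sub (y : Fin (m i) → ℝ) :
    (M.D⁻¹ + (M.Z i)ᵀ * (M.Sig i)⁻¹ * M.Z i) *ᵥ (M.muB i y - M.c • M.Delta) =
      ((M.Z i)ᵀ * (M.Sig i)⁻¹) *ᵥ (y - M.X i *ᵥ M.beta - M.c • (M.Z i *ᵥ M.Delta)) := by
  have h : M.muB i y - M.c • M.Delta = (M.D * (M.Z i)ᵀ * (M.Psi i)⁻¹) *ᵥ
      (y - M.X i *ᵥ M.beta - M.c • (M.Z i *ᵥ M.Delta)) := by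
    rw [muB, add_sub_cancel_left, y0, mulVec_mulVec, Matrix.mul_assoc _ (invSqrtM _),
      invSqrtM_mul_invSqrtM (M.posDef_Psi i)]
  rw [h, mulVec_mulVec, Psi,
    inv_add_mul_mul_transpose_mul_inv M.posDef_D (M.posDef_Sig i) (M.posDef_Psi i)]

lemma A_eq (y : Fin (m i) → ℝ) :
    M.A i y = (M.s i)⁻¹ * (M.zeta ⬝ᵥ (M.muB i y - M.c • M.Delta)) := by
  have hD : (M.D)ᵀ = M.D := by simpa using M.posDef_D.isHermitian.eq
  have ht : (M.D * (M.Z i)ᵀ * invSqrtM (M.Psi i))ᵀ = invSqrtM (M.Psi i) * M.Z i * M.D := by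
    rw [transpose_mul, transpose_mul, transpose_transpose, transpose_invSqrtM, hD,
      Matrix.mul_assoc]
  rw [A, lamBar, smul_dotProduct, smul_eq_mul, muB, add_sub_cancel_left, dotProduct_mulVec,
    ← mulVec_transpose, ht]

/-- The density of `(b_i, e_i)` given `U_i = u`, up to normalisation, at the errors
`y - X_i β - Z_i x`. -/
lemma exists_exp_mul_stdNormalCDF_eq (u : ℝ) (y : Fin (m i) → ℝ) :
    ∃ κ : ℝ, ∀ x : Fin q → ℝ,
      Real.exp (-(u * ((Sum.elim x (y - M.X i *ᵥ M.beta - M.Z i *ᵥ x) -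
          Sum.elim (M.c • M.Delta) 0) ⬝ᵥ (fromBlocks M.D 0 0 (M.Sig i))⁻¹ *ᵥ
          (Sum.elim x (y - M.X i *ᵥ M.beta - M.Z i *ᵥ x) - Sum.elim (M.c • M.Delta) 0))) / 2) *
        stdNormalCDF (Real.sqrt u * (Sum.elim M.lam 0 ⬝ᵥ
          invSqrtM (fromBlocks M.D 0 0 (M.Sig i)) *ᵥ
          (Sum.elim x (y - M.X i *ᵥ M.beta - M.Z i *ᵥ x) - Sum.elim (M.c • M.Delta) 0))) =
      κ * (Real.exp (-(u * ((x - M.muB i y) ⬝ᵥ (M.D⁻¹ + (M.Z i)ᵀ * (M.Sig i)⁻¹ * M.Z i) *ᵥ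
          (x - M.muB i y))) / 2) *
        stdNormalCDF (Real.sqrt u * (M.zeta ⬝ᵥ (x - M.c • M.Delta)))) := by
  set d := y - M.X i *ᵥ M.beta - M.c • (M.Z i *ᵥ M.Delta) with hd
  set L := M.D⁻¹ + (M.Z i)ᵀ * (M.Sig i)⁻¹ * M.Z i with hL
  set r := M.muB i y - M.c • M.Delta with hr
  refine ⟨Real.exp (-(u * (d ⬝ᵥ (M.Sig i)⁻¹ *ᵥ d - r ⬝ᵥ L *ᵥ r)) / 2), fun x => ?_⟩
  have hw : Sum.elim x (y - M.X i *ᵥ M.beta - M.Z i *ᵥ x) - Sum.elim (M.c • M.Delta) 0 =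
      Sum.elim (x - M.c • M.Delta) (d - M.Z i *ᵥ (x - M.c • M.Delta)) := by
    rw [← Sum.elim_sub_sub, sub_zero, hd, mulVec_sub, mulVec_smul]
    congr 1
    abel
  have hq := quadratic_add_quadratic_eq M.posDef_D.inv.isHermitian (M.posDef_Sig i).inv.isHermitian
    (M.Z i) d (x - M.c • M.Delta) r (M.precision_mulVec_muB_sub i y)
  rw [← hL, hr, sub_sub_sub_cancel_right, ← hr] at hq
  rw [hw, inv_fromBlocks_diagonal M.posDef_D (M.posDef_Sig i),
    invSqrtM_fromBlocks_diagonal M.posDef_D (M.posDef_Sig i), fromBlocks_mulVec, fromBlocks_mulVec,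
    sumElim_dotProduct_sumElim, sumElim_dotProduct_sumElim]
  simp only [Sum.elim_comp_inl, Sum.elim_comp_inr, zero_mulVec, add_zero, zero_add,
    zero_dotProduct]
  rw [hq, ← invSqrtM_mulVec_dotProduct, ← mul_assoc, ← Real.exp_add, zeta]
  congr 2
  ring

/-- The conditional mean of `b_i` given `U_i = u` and `Y_i = y`, as an identity between integrals
of the joint density. -/
lemma integral_density_smul_sub_muB {u : ℝ} (hu : 0 < u) (y : Fin (m i) → ℝ) (C : ℝ)
    {f : (Fin q → ℝ) → ℝ} (hf : ∀ x, f x = C *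
      (Real.exp (-(u * ((Sum.elim x (y - M.X i *ᵥ M.beta - M.Z i *ᵥ x) -
          Sum.elim (M.c • M.Delta) 0) ⬝ᵥ (fromBlocks M.D 0 0 (M.Sig i))⁻¹ *ᵥ
          (Sum.elim x (y - M.X i *ᵥ M.beta - M.Z i *ᵥ x) - Sum.elim (M.c • M.Delta) 0))) / 2) *
        stdNormalCDF (Real.sqrt u * (Sum.elim M.lam 0 ⬝ᵥ
          invSqrtM (fromBlocks M.D 0 0 (M.Sig i)) *ᵥ
          (Sum.elim x (y - M.X i *ᵥ M.beta - M.Z i *ᵥ x) - Sum.elim (M.c • M.Delta) 0)))))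
    (hi : Integrable fun x => f x • (x - M.muB i y)) :
    ∫ x, f x • (x - M.muB i y) =
      (∫ x, f x) • ((tauIntegrand (M.A i y) u / M.s i) • (M.Lambda i *ᵥ M.zeta)) := by
  obtain ⟨κ, hκ⟩ := M.exists_exp_mul_stdNormalCDF_eq i u y
  set r := M.muB i y - M.c • M.Delta with hr
  set L := M.D⁻¹ + (M.Z i)ᵀ * (M.Sig i)⁻¹ * M.Z i with hL
  set g : (Fin q → ℝ) → ℝ := fun x => Real.exp (-(u * ((x - r) ⬝ᵥ L *ᵥ (x - r))) / 2) *
    stdNormalCDF (Real.sqrt u * (M.zeta ⬝ᵥ x)) with hg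
  have hfg : ∀ x, f x = C * κ * g (x - M.c • M.Delta) := by
    intro x
    rw [hf, hκ, hg]
    simp only [hr, sub_sub_sub_cancel_right, mul_assoc]
  have hden : ∫ x, f x = C * κ * ∫ x, g x := by
    simp_rw [hfg]
    rw [integral_const_mul, integral_sub_right_eq_self g]
  ext j
  rw [eval_integral fun j => hi.eval j]
  have hnum : ∫ x, (f x • (x - M.muB i y)) j =
      C * κ * ∫ x, ((x - r) ⬝ᵥ Pi.single j 1) * g x := by
    rw [← integral_const_mul, ← integral_sub_right_eq_self
      (fun x => C * κ * (((x - r) ⬝ᵥ Pi.single j 1) * g x)) (M.c • M.Delta)]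
    congr 1 with x
    rw [hfg, Pi.smul_apply, smul_eq_mul, hr, sub_sub_sub_cancel_right, dotProduct_single_one]
    ring
  have h := integral_dotProduct_mul_skewNormal (M.posDef_precision i) hu r M.zeta (Pi.single j 1)
  rw [hnum, hden, h, A_eq, ← hL, ← hr, ← hg, dotProduct_single_one]
  simp only [Pi.smul_apply, smul_eq_mul, s, Lambda, ← hL]
  ring

end Params

lemma measurable_tauIntegrand_uncurry : Measurable fun p : ℝ × ℝ => tauIntegrand p.1 p.2 := by
  unfold tauIntegrand WPhi
  have h := continuous_stdNormalCDF.measurable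
  have h' := (continuous_gaussianPDFReal 0 1).measurable
  have h2 : Measurable fun p : ℝ × ℝ => Real.sqrt p.2 * p.1 := by fun_prop
  exact (by fun_prop : Measurable fun p : ℝ × ℝ => (Real.sqrt p.2)⁻¹).mul
    ((h'.comp h2).div (h.comp h2))

lemma integrable_mulVec {Ω κ ι : Type*} [MeasurableSpace Ω] {P : Measure Ω} [Fintype ι] [Fintype κ]
    (A : Matrix κ ι ℝ) {f : Ω → ι → ℝ} (hf : Integrable f P) :
    Integrable (fun ω => A *ᵥ f ω) P :=
  (LinearMap.toContinuousLinearMap A.mulVecLin).integrable_comp hf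

namespace Params

variable {n q l : ℕ} {m : Fin n → ℕ} (M : Params n q l m) (i : Fin n)

lemma continuous_muB : Continuous (M.muB i) := by
  unfold muB y0
  fun_prop

lemma continuous_A : Continuous (M.A i) := by
  unfold A y0
  fun_prop

namespace IsModel

variable {M} {Ω : Type*} [MeasurableSpace Ω] {P : Measure Ω}
  {b : Fin n → Ω → Fin q → ℝ} {e : (i : Fin n) → Ω → Fin (m i) → ℝ}
  {U : Fin n → Ω → ℝ} {Y : (i : Fin n) → Ω → Fin (m i) → ℝ}

lemma measurable_Y (hM : M.IsModel P b e U Y) : Measurable (Y i) := by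
  have hb := hM.measurable_b i
  have he := hM.measurable_e i
  rw [funext (hM.response i)]
  exact (measurable_const.add ((by fun_prop : Continuous fun x : Fin q → ℝ =>
    M.Z i *ᵥ x).measurable.comp hb)).add he

lemma measurable_elim (hM : M.IsModel P b e U Y) :
    Measurable fun ω => Sum.elim (b i ω) (e i ω) := by
  have hb := hM.measurable_b i
  have he := hM.measurable_e i
  refine measurable_pi_iff.2 fun j => ?_
  cases j <;> simp only [Sum.elim_inl, Sum.elim_inr] <;> fun_prop

lemma integrable_inv_sqrt (hM : M.IsModel P b e U Y) :
    Integrable (fun ω => (Real.sqrt (U i ω))⁻¹) P := by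
  have := M.isProbabilityMeasure_H
  exact (hM.smsn i).integrable_inv_sqrt (posDef_fromBlocks_diagonal M.posDef_D (M.posDef_Sig i))
    M.H_nonpos M.integrable_k1 (hM.measurable_U i) (hM.measurable_elim i)

variable [IsProbabilityMeasure P]

lemma integrable_elim (hM : M.IsModel P b e U Y) :
    Integrable (fun ω => Sum.elim (b i ω) (e i ω)) P := by
  have := M.isProbabilityMeasure_H
  exact (hM.smsn i).integrable (posDef_fromBlocks_diagonal M.posDef_D (M.posDef_Sig i)) M.H_nonpos
    M.integrable_k1 (hM.measurable_U i) (hM.measurable_elim i)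

lemma integrable_b (hM : M.IsModel P b e U Y) : Integrable (b i) P :=
  Integrable.of_eval fun j => (hM.integrable_elim i).eval (Sum.inl j)

lemma integrable_e (hM : M.IsModel P b e U Y) : Integrable (e i) P :=
  Integrable.of_eval fun j => (hM.integrable_elim i).eval (Sum.inr j)

lemma integrable_Y (hM : M.IsModel P b e U Y) : Integrable (Y i) P := by
  rw [funext (hM.response i)]
  exact ((integrable_const _).add (integrable_mulVec _ (hM.integrable_b i))).add (hM.integrable_e i)

lemma integrable_muB (hM : M.IsModel P b e U Y) : Integrable (fun ω => M.muB i (Y i ω)) P := by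
  unfold muB y0
  exact (integrable_const _).add (integrable_mulVec _ (integrable_mulVec _
    (((hM.integrable_Y i).sub (integrable_const _)).sub (integrable_const _))))

/-- The conditional mean of `b_i` given `(U_i, Y_i)`. -/
lemma integrable_and_condExp_sub_muB_ae_eq (hM : M.IsModel P b e U Y) :
    Integrable (fun ω => (tauIntegrand (M.A i (Y i ω)) (U i ω) / M.s i) •
        (M.Lambda i *ᵥ M.zeta)) P ∧
      P[fun ω => b i ω - M.muB i (Y i ω) |
          MeasurableSpace.comap (fun ω => (U i ω, Y i ω)) inferInstance] =ᵐ[P]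
        fun ω => (tauIntegrand (M.A i (Y i ω)) (U i ω) / M.s i) • (M.Lambda i *ᵥ M.zeta) := by
  have := M.isProbabilityMeasure_H
  have hS := posDef_fromBlocks_diagonal M.posDef_D (M.posDef_Sig i)
  set S := fromBlocks M.D 0 0 (M.Sig i) with hSdef
  set C := 2 * (Real.sqrt ((2 * Real.pi) ^ Fintype.card (Fin q ⊕ Fin (m i)) * S.det))⁻¹
  have hcont := continuous_skewNormal_density C (Sum.elim (M.c • M.Delta) 0)
    (Sum.elim M.lam 0) S
  have hmap := map_eq_withDensity_of_linear_response (hM.measurable_U i) (hM.measurable_b i)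
    (hM.measurable_e i) (M.X i *ᵥ M.beta) (M.Z i) (hM.response i)
    hcont.measurable.ennreal_ofReal ((hM.smsn i).map_eq_withDensity hS M.H_nonpos)
  have helim : Continuous fun p : (ℝ × (Fin (m i) → ℝ)) × (Fin q → ℝ) =>
      (p.1.1, Sum.elim p.2 (p.1.2 - M.X i *ᵥ M.beta - M.Z i *ᵥ p.2)) := by
    refine Continuous.prodMk (by fun_prop) (continuous_pi fun j => ?_)
    cases j <;> simp only [Sum.elim_inl, Sum.elim_inr] <;> fun_prop
  have hh : StronglyMeasurable fun p : (ℝ × (Fin (m i) → ℝ)) × (Fin q → ℝ) =>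
      p.2 - M.muB i p.1.2 := by
    have := M.continuous_muB i
    exact (by fun_prop : Continuous fun p : (ℝ × (Fin (m i) → ℝ)) × (Fin q → ℝ) =>
      p.2 - M.muB i p.1.2).stronglyMeasurable
  have hG : StronglyMeasurable fun x : ℝ × (Fin (m i) → ℝ) =>
      (tauIntegrand (M.A i x.2) x.1 / M.s i) • (M.Lambda i *ᵥ M.zeta) := by
    have h1 : Measurable fun x : ℝ × (Fin (m i) → ℝ) => tauIntegrand (M.A i x.2) x.1 :=
      measurable_tauIntegrand_uncurry.comp
        (((M.continuous_A i).measurable.comp measurable_snd).prodMk measurable_fst)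
    exact ((h1.div_const _).smul_const _).stronglyMeasurable
  refine integrable_and_condExp_ae_eq_of_map_eq_withDensity
    ((hM.measurable_U i).prodMk (hM.measurable_Y i)) (hM.measurable_b i)
    (hcont.comp helim).measurable (fun p => ?_) hmap hh
    ((hM.integrable_b i).sub (hM.integrable_muB i)) hG ?_
  · exact mul_nonneg (by positivity) (mul_nonneg (Real.exp_pos _).le (stdNormalCDF_pos _).le)
  · filter_upwards [Measure.quasiMeasurePreserving_fst.ae
      (ae_pos_of_measure_Iic_eq_zero M.H_nonpos)] with x hx hi
    exact M.integral_density_smul_sub_muB i hx x.2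
      (C * Real.sqrt x.1 ^ Fintype.card (Fin q ⊕ Fin (m i))) (fun _ => rfl) hi

lemma integrable_tauIntegrand (hM : M.IsModel P b e U Y) :
    Integrable (fun ω => tauIntegrand (M.A i (Y i ω)) (U i ω)) P := by
  have hs : M.s i ≠ 0 := by
    have h := (M.posDef_precision i).inv.posSemidef.dotProduct_mulVec_nonneg M.zeta
    rw [star_trivial] at h
    exact (Real.sqrt_pos.2 (add_pos_of_pos_of_nonneg one_pos h)).ne'
  by_cases hz : M.zeta = 0
  · have hA : ∀ y, M.A i y = 0 := fun y => by rw [A_eq, hz, zero_dotProduct, mul_zero]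
    simp only [hA, tauIntegrand, mul_zero]
    exact (hM.integrable_inv_sqrt i).mul_const _
  · have hL : M.Lambda i *ᵥ M.zeta ≠ 0 := fun h0 =>
      hz (mulVec_injective_of_isUnit (M.posDef_precision i).inv.isUnit
        (h0.trans (mulVec_zero _).symm))
    have h := (hM.integrable_and_condExp_sub_muB_ae_eq i).1
    rw [integrable_smul_const hL] at h
    simpa [hs] using h.mul_const (M.s i)

end IsModel

end Params

end SkewLMM

end

open SkewLMM in
theorem mainTheorem4 {n q l : ℕ} {m : Fin n → ℕ} (M : SkewLMM.Params n q l m)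
    {Ω : Type*} [MeasurableSpace Ω] (P : Measure Ω) [IsProbabilityMeasure P]
    (b : Fin n → Ω → Fin q → ℝ) (e : (i : Fin n) → Ω → Fin (m i) → ℝ)
    (U : Fin n → Ω → ℝ) (Y : (i : Fin n) → Ω → Fin (m i) → ℝ)
    (hM : M.IsModel P b e U Y) (i : Fin n) :
    Integrable (b i) P ∧
    SkewLMM.IsMinMSEPredictor P (b i) (Y i) (SkewLMM.condMean P (b i) (Y i)) ∧
    ∀ᵐ y ∂(P.map (Y i)),
      Integrable (fun v : Fin q → ℝ => v) (condDistrib (b i) (Y i) P y) ∧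
      Integrable (SkewLMM.tauIntegrand (M.A i y)) (condDistrib (U i) (Y i) P y) ∧
      SkewLMM.condMean P (b i) (Y i) y =
        ∫ u, SkewLMM.condMean P (b i) (fun ω => (U i ω, Y i ω)) (u, y)
          ∂(condDistrib (U i) (Y i) P y) ∧
      SkewLMM.condMean P (b i) (Y i) y =
        M.muB i y +
          (SkewLMM.tauNegOne P (U i) (Y i) (M.A i) y /
            Real.sqrt (1 + M.zeta ⬝ᵥ M.Lambda i *ᵥ M.zeta)) • (M.Lambda i *ᵥ M.zeta) := by
  have hb := hM.integrable_b i
  have hbm := hM.measurable_b i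
  have hYm := hM.measurable_Y i
  have hUm := hM.measurable_U i
  have hτ := hM.integrable_tauIntegrand i
  refine ⟨hb, isMinMSEPredictor_condMean hYm hbm hb, ?_⟩
  have hUY : Measurable fun ω => (U i ω, Y i ω) := hUm.prodMk hYm
  have hle : MeasurableSpace.comap (Y i) inferInstance ≤
      MeasurableSpace.comap (fun ω => (U i ω, Y i ω)) inferInstance := by
    rintro s ⟨t, ht, rfl⟩
    exact ⟨Prod.snd ⁻¹' t, measurable_snd ht, rfl⟩
  have htower := condExp_condExp_of_le (f := b i) (μ := P) hle hUY.comap_le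
  have hmeas := measurable_condMean (P := P) (b i) (Y i)
  have hτm : Measurable fun p : (Fin (m i) → ℝ) × ℝ => tauIntegrand (M.A i p.1) p.2 :=
    measurable_tauIntegrand_uncurry.comp
      (((M.continuous_A i).measurable.comp measurable_fst).prodMk measurable_snd)
  have hτint : ∀ᵐ y ∂(P.map (Y i)), Integrable (tauIntegrand (M.A i y))
      (condDistrib (U i) (Y i) P y) := by
    refine Integrable.condDistrib_ae_map
      (f := fun p : (Fin (m i) → ℝ) × ℝ => tauIntegrand (M.A i p.1) p.2) hUm.aemeasurable ?_
    exact (integrable_map_measure hτm.aestronglyMeasurable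
      (hYm.prodMk hUm).aemeasurable).2 hτ
  -- the iterated conditional mean
  have hcond : P[b i | MeasurableSpace.comap (fun ω => (U i ω, Y i ω)) inferInstance] =ᵐ[P]
      fun ω => condMean P (b i) (fun ω => (U i ω, Y i ω)) (U i ω, Y i ω) :=
    condExp_ae_eq_condMean hUY hb
  have hiter : StronglyMeasurable fun p : (Fin (m i) → ℝ) × ℝ =>
      condMean P (b i) (fun ω => (U i ω, Y i ω)) (p.2, p.1) :=
    ((measurable_condMean (P := P) (b i) fun ω => (U i ω, Y i ω)).comp
      measurable_swap).stronglyMeasurable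
  have h1 : ∀ᵐ y ∂(P.map (Y i)), condMean P (b i) (Y i) y =
      ∫ u, condMean P (b i) (fun ω => (U i ω, Y i ω)) (u, y) ∂(condDistrib (U i) (Y i) P y) := by
    rw [ae_map_iff hYm.aemeasurable
      (measurableSet_eq_fun hmeas hiter.integral_condDistrib.measurable)]
    have h2 := condExp_prod_ae_eq_integral_condDistrib hYm hUm.aemeasurable hiter
      (integrable_condExp.congr hcond)
    filter_upwards [h2, htower, condExp_congr_ae (m := MeasurableSpace.comap (Y i) inferInstance)
      hcond, condExp_ae_eq_condMean hYm hb] with ω h3 h4 h5 h6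
    rw [← h6, ← h4, h5, h3]
  -- the explicit formula
  have hexp : StronglyMeasurable fun p : (Fin (m i) → ℝ) × ℝ =>
      M.muB i p.1 + (tauIntegrand (M.A i p.1) p.2 / M.s i) • (M.Lambda i *ᵥ M.zeta) :=
    ((((M.continuous_muB i).measurable.comp measurable_fst).add
      ((hτm.div_const _).smul_const _))).stronglyMeasurable
  have hcond' : P[b i | MeasurableSpace.comap (fun ω => (U i ω, Y i ω)) inferInstance] =ᵐ[P]
      fun ω => M.muB i (Y i ω) +
        (tauIntegrand (M.A i (Y i ω)) (U i ω) / M.s i) • (M.Lambda i *ᵥ M.zeta) := by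
    have hmu : StronglyMeasurable[MeasurableSpace.comap (fun ω => (U i ω, Y i ω)) inferInstance]
        fun ω => M.muB i (Y i ω) :=
      (((M.continuous_muB i).measurable.comp measurable_snd).comp
        (Measurable.of_comap_le (f := fun ω => (U i ω, Y i ω)) le_rfl)).stronglyMeasurable
    filter_upwards [(hM.integrable_and_condExp_sub_muB_ae_eq i).2,
      condExp_sub hb (hM.integrable_muB i)
        (MeasurableSpace.comap (fun ω => (U i ω, Y i ω)) inferInstance)] with ω h2 h3
    have h4 := congrFun (condExp_of_stronglyMeasurable hUY.comap_le hmu (hM.integrable_muB i)) ω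
    rw [← h2, ← h4]
    exact (sub_eq_iff_eq_add'.1 h3.symm)
  have h2 : ∀ᵐ y ∂(P.map (Y i)), condMean P (b i) (Y i) y =
      ∫ u, (M.muB i y + (tauIntegrand (M.A i y) u / M.s i) • (M.Lambda i *ᵥ M.zeta))
        ∂(condDistrib (U i) (Y i) P y) := by
    rw [ae_map_iff hYm.aemeasurable
      (measurableSet_eq_fun hmeas hexp.integral_condDistrib.measurable)]
    have h3 := condExp_prod_ae_eq_integral_condDistrib hYm hUm.aemeasurable hexp
      (integrable_condExp.congr hcond')
    filter_upwards [h3, htower, condExp_congr_ae (m := MeasurableSpace.comap (Y i) inferInstance)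
      hcond', condExp_ae_eq_condMean hYm hb] with ω h4 h5 h6 h7
    rw [← h7, ← h5, h6, h4]
  filter_upwards [ae_integrable_condDistrib hYm hb, hτint, h1, h2] with y hy1 hy2 hy3 hy4
  refine ⟨hy1, hy2, hy3, ?_⟩
  rw [hy4, integral_add (integrable_const _) ((hy2.div_const _).smul_const _), integral_const,
    integral_smul_const, integral_div]
  simp [tauNegOne, Params.s]
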